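/- Let $\mathfrak g$ be a five-dimensional real Lie algebra belonging to Block IV of Mubarakzyanov's list, i.e. isomorphic to one of the algebras $\mathfrak g_{5,19},\dots,\mathfrak g_{5,29}$. That is, $\mathfrak g$ has a basis $e_1,\dots,e_5$ with $[e_2,e_3]=e_1$, $[e_1,e_2]=[e_1,e_3]=[e_1,e_4]=[e_2,e_4]=[e_3,e_4]=0$, and with $([e_1,e_5],[e_2,e_5],[e_3,e_5],[e_4,e_5])$ given by one of the following lines, where $\alpha,\beta,p\in\mathbb R$, $\beta\neq0$, $\varepsilon=\pm1$: - $\mathfrak g_{5,19}$: $\bigl((1+\alpha)e_1,\ e_2,\ \alpha e_3,\ \beta e_4\bigr)$; - $\mathfrak g_{5,20}$: $\bigl((1+\alpha)e_1,\ e_2,\ \alpha e_3,\ e_1+(1+\alpha)e_4\bigr)$; - $\mathfrak g_{5,21}$: $\bigl(2e_1,\ e_2+e_3,\ e_3+e_4,\ e_4\bigr)$; - $\mathfrak g_{5,22}$: $\bigl(0,\ e_3,\ 0,\ e_4\bigr)$; - $\mathfrak g_{5,23}$: $\bigl(2e_1,\ e_2+e_3,\ e_3,\ \beta e_4\bigr)$;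 - $\mathfrak g_{5,24}$: $\bigl(2e_1,\ e_2+e_3,\ e_3,\ \varepsilon e_1+2e_4\bigr)$; - $\mathfrak g_{5,25}$: $\bigl(2pe_1,\ pe_2+e_3,\ -e_2+pe_3,\ \beta e_4\bigr)$; - $\mathfrak g_{5,26}$: $\bigl(2pe_1,\ pe_2+e_3,\ -e_2+pe_3,\ \varepsilon e_1+2pe_4\bigr)$; - $\mathfrak g_{5,27}$: $\bigl(e_1,\ 0,\ e_3+e_4,\ e_1+e_4\bigr)$; - $\mathfrak g_{5,28}$: $\bigl((1+\alpha)e_1,\ \alpha e_2,\ e_3+e_4,\ e_4\bigr)$; - $\mathfrak g_{5,29}$: $\bigl(e_1,\ e_2,\ e_4,\ 0\bigr)$. Then $\mathfrak g$ contains an ideal isomorphic to $\mathfrak g_{3,1}+\mathfrak g_1$, the direct sum of the three-dimensional Heisenberg algebra and the one-dimensional algebra. Moreover, let $M$ be a germ at $p$ of a real-analytic real hypersurface in $\mathbb C^3$ that is homogeneous and associated with $\mathfrak g$: near $p$ there is a realization of $\mathfrak g$ by holomorphic vector fields which are tangent to $M$ (a holomorphic field $X$ being identified with the real field $2\operatorname{Re}X$)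 and whose values at $p$ cover $T_pM$. Then either $M$ is Levi-degenerate at $p$, or there are a real-analytic surface germ $\Gamma\subset\mathbb R^3$ at some point $x$ and a point $q$ with $\operatorname{Re}q=x$ such that $\Gamma$ is affinely homogeneous at $x$ (the affine vector fields tangent to $\Gamma$ near $x$ cover $T_x\Gamma$ by their values at $x$), the tube $\Gamma+i\mathbb R^3$ is Levi-nondegenerate at $q$, and some biholomorphic map between neighbourhoods of $p$ and $q$ sends $p$ to $q$ and the germ of $M$ at $p$ onto the germ of $\Gamma+i\mathbb R^3$ at $q$. -/

import Mathlib

open scoped Topology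

namespace CRHyp

/-! ### Real-analytic hypersurface germs -/

section Hypersurface

variable {V : Type*} [NormedAddCommGroup V] [NormedSpace ℝ V]

/-- `Φ` is a local real-analytic defining function of `N` at the point `p ∈ N`: near `p` the set `N`
is the zero set of `Φ`, and `dΦ(p) ≠ 0`. The tangent space of `N` at a point `z ∈ N` near `p` is then
the kernel of `fderiv ℝ Φ z`. -/
structure IsDefiningFunctionAt (Φ : V → ℝ) (N : Set V) (p : V) : Prop where
  analyticAt : AnalyticAt ℝ Φ p
  map_eq_zero : Φ p = 0
  fderiv_ne_zero : fderiv ℝ Φ p ≠ 0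
  mem_iff : ∀ᶠ z in 𝓝 p, (z ∈ N ↔ Φ z = 0)

end Hypersurface

/-! ### The Levi form -/

/-- The space `ℂ³`; the coordinates `z₁, z₂, w` are numbered `0, 1, 2`. -/
abbrev C3 : Type := Fin 3 → ℂ

/-- The space `ℝ³`. -/
abbrev R3 : Type := Fin 3 → ℝ

/-- The real second differential of `Φ` at `p`. -/
noncomputable def hess (Φ : C3 → ℝ) (p v w : C3) : ℝ :=
  fderiv ℝ (fderiv ℝ Φ) p v w

/-- The Hermitian form `∑ j k, (∂²Φ / ∂z_j ∂z̄_k)(p) v_j w̄_k`, written out through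
`∂/∂z = (∂/∂x - i ∂/∂y) / 2` and `∂/∂z̄ = (∂/∂x + i ∂/∂y) / 2`. -/
noncomputable def leviForm (Φ : C3 → ℝ) (p v w : C3) : ℂ :=
  (1 / 4 : ℂ) *
    (((hess Φ p v w + hess Φ p (Complex.I • v) (Complex.I • w) : ℝ) : ℂ) +
      Complex.I *
        ((hess Φ p v (Complex.I • w) - hess Φ p (Complex.I • v) w : ℝ) : ℂ))

/-- `v` lies in the complex tangent space `T ∩ iT` at `p` of the hypersurface `Φ = 0`. -/
def IsComplexTangent (Φ : C3 → ℝ) (p v : C3) : Prop :=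
  fderiv ℝ Φ p v = 0 ∧ fderiv ℝ Φ p (Complex.I • v) = 0

/-- The Levi form of `Φ = 0` at `p`, i.e. `leviForm Φ p` restricted to the complex tangent space,
has a nonzero kernel. -/
def HasLeviKernel (Φ : C3 → ℝ) (p : C3) : Prop :=
  ∃ v : C3, v ≠ 0 ∧ IsComplexTangent Φ p v ∧
    ∀ w : C3, IsComplexTangent Φ p w → leviForm Φ p v w = 0

/-- The germ at `p` of the real-analytic hypersurface `M` is Levi-degenerate. -/
def LeviDegenerateAt (M : Set C3) (p : C3) : Prop :=
  ∃ Φ : C3 → ℝ, IsDefiningFunctionAt Φ M p ∧ HasLeviKernel Φ p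

/-- The germ at `p` of the real-analytic hypersurface `M` is Levi-nondegenerate. -/
def LeviNondegenerateAt (M : Set C3) (p : C3) : Prop :=
  ∃ Φ : C3 → ℝ, IsDefiningFunctionAt Φ M p ∧ ¬ HasLeviKernel Φ p

/-! ### Local holomorphic equivalence, tubes, affine homogeneity -/

/-- The germ of `M` at `p` is mapped onto the germ of `N` at `q` by a biholomorphic map between
neighbourhoods of `p` and `q` that sends `p` to `q`. -/
def HolomorphicallyEquivalentAt (M : Set C3) (p : C3) (N : Set C3) (q : C3) : Prop :=
  ∃ F : OpenPartialHomeomorph C3 C3,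
    p ∈ F.source ∧ F p = q ∧
    DifferentiableOn ℂ F F.source ∧ DifferentiableOn ℂ F.symm F.target ∧
    ∀ z ∈ F.source, (z ∈ M ↔ F z ∈ N)

/-- The coordinatewise real part. -/
def rePart (z : C3) : R3 := fun j => (z j).re

/-- The tube `Γ + iℝ³` over the base `Γ`. -/
def tube (Γ : Set R3) : Set C3 := {z | rePart z ∈ Γ}

/-- The germ at `x` of the real-analytic surface `Γ ⊆ ℝ³` is affinely homogeneous: the affine vector
fields `y ↦ A y + b` that are tangent to `Γ` near `x` (they form a Lie algebra) cover by their values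
at `x` the whole tangent plane. -/
def AffinelyHomogeneousAt (Γ : Set R3) (x : R3) : Prop :=
  ∃ φ : R3 → ℝ, IsDefiningFunctionAt φ Γ x ∧
    ∀ v : R3, fderiv ℝ φ x v = 0 →
      ∃ X : R3 →ᵃ[ℝ] R3, X x = v ∧ ∀ᶠ y in 𝓝 x, y ∈ Γ → fderiv ℝ φ y (X y) = 0

/-! ### The Lie algebras -/

section LieAlgebras

variable {L : Type*} [LieRing L] [LieAlgebra ℝ L]

/-- Commutation relations of `e₁, …, e₅` (numbered `0, …, 4`): `[e₂, e₃] = e₁`, the other brackets of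
`e₁, …, e₄` vanish, and `[e₁, e₅] = b₁`, `[e₂, e₅] = b₂`, `[e₃, e₅] = b₃`, `[e₄, e₅] = b₄`. -/
structure Relations (e : Fin 5 → L) (b₁ b₂ b₃ b₄ : L) : Prop where
  e12 : ⁅e 0, e 1⁆ = 0
  e13 : ⁅e 0, e 2⁆ = 0
  e14 : ⁅e 0, e 3⁆ = 0
  e23 : ⁅e 1, e 2⁆ = e 0
  e24 : ⁅e 1, e 3⁆ = 0
  e34 : ⁅e 2, e 3⁆ = 0
  e15 : ⁅e 0, e 4⁆ = b₁
  e25 : ⁅e 1, e 4⁆ = b₂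
  e35 : ⁅e 2, e 4⁆ = b₃
  e45 : ⁅e 3, e 4⁆ = b₄

/-- The commutation relations of the algebras `g_{5,19}, …, g_{5,29}`. -/
inductive BlockIVRelations (e : Fin 5 → L) : Prop
  | g19 (α β : ℝ) (hβ : β ≠ 0)
      (h : Relations e ((1 + α) • e 0) (e 1) (α • e 2) (β • e 3))
  | g20 (α : ℝ)
      (h : Relations e ((1 + α) • e 0) (e 1) (α • e 2) (e 0 + (1 + α) • e 3))
  | g21
      (h : Relations e ((2 : ℝ) • e 0) (e 1 + e 2) (e 2 + e 3) (e 3))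
  | g22
      (h : Relations e 0 (e 2) 0 (e 3))
  | g23 (β : ℝ) (hβ : β ≠ 0)
      (h : Relations e ((2 : ℝ) • e 0) (e 1 + e 2) (e 2) (β • e 3))
  | g24 (ε : ℝ) (hε : ε = 1 ∨ ε = -1)
      (h : Relations e ((2 : ℝ) • e 0) (e 1 + e 2) (e 2) (ε • e 0 + (2 : ℝ) • e 3))
  | g25 (p β : ℝ) (hβ : β ≠ 0)
      (h : Relations e ((2 * p) • e 0) (p • e 1 + e 2) (-e 1 + p • e 2) (β • e 3))
  | g26 (p ε : ℝ) (hε : ε = 1 ∨ ε = -1)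
      (h : Relations e ((2 * p) • e 0) (p • e 1 + e 2) (-e 1 + p • e 2)
        (ε • e 0 + (2 * p) • e 3))
  | g27
      (h : Relations e (e 0) 0 (e 2 + e 3) (e 0 + e 3))
  | g28 (α : ℝ)
      (h : Relations e ((1 + α) • e 0) (α • e 1) (e 2 + e 3) (e 3))
  | g29
      (h : Relations e (e 0) (e 1) (e 3) 0)

end LieAlgebras

/-- The real Lie algebra `L` is (isomorphic to) one of `g_{5,19}, …, g_{5,29}`. -/
def IsBlockIV (L : Type*) [LieRing L] [LieAlgebra ℝ L] : Prop :=
  ∃ e : Module.Basis (Fin 5) ℝ L, BlockIVRelations e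

/-- The real Lie algebra `K` is (isomorphic to) `g_{3,1} + g_1`, the direct sum of the Heisenberg
algebra and the one-dimensional algebra. -/
def IsHeisenbergPlusLine (K : Type*) [LieRing K] [LieAlgebra ℝ K] : Prop :=
  ∃ f : Module.Basis (Fin 4) ℝ K,
    ⁅f 1, f 2⁆ = f 0 ∧ ⁅f 0, f 1⁆ = 0 ∧ ⁅f 0, f 2⁆ = 0 ∧
    ⁅f 0, f 3⁆ = 0 ∧ ⁅f 1, f 3⁆ = 0 ∧ ⁅f 2, f 3⁆ = 0

/-- The germ at `p` of the real-analytic hypersurface `M ⊆ ℂ³` is a homogeneous hypersurface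
associated with the Lie algebra `L`: on some neighbourhood `U` of `p` there is a realization `ρ` of
`L` by holomorphic vector fields, tangent to `M`, whose values at `p` cover the tangent space of `M`.
A holomorphic field `f ∂/∂z₁ + g ∂/∂z₂ + h ∂/∂w` is the map `(f, g, h)`, read as the real field
`2 Re (f ∂/∂z₁ + g ∂/∂z₂ + h ∂/∂w)` when it acts on real functions. -/
def IsAssociatedWith (M : Set C3) (p : C3) (L : Type*) [LieRing L] [LieAlgebra ℝ L] : Prop :=
  ∃ Φ : C3 → ℝ, IsDefiningFunctionAt Φ M p ∧
    ∃ (U : Set C3) (ρ : L →ₗ[ℝ] (C3 → C3)),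
      IsOpen U ∧ p ∈ U ∧
      (∀ X : L, DifferentiableOn ℂ (ρ X) U) ∧
      (∀ X Y : L, ∀ z ∈ U, ρ ⁅X, Y⁆ z = VectorField.lieBracket ℂ (ρ X) (ρ Y) z) ∧
      (∀ X : L, ∀ z ∈ M ∩ U, fderiv ℝ Φ z (ρ X z) = 0) ∧
      (∀ v : C3, fderiv ℝ Φ p v = 0 → ∃ X : L, ρ X p = v)

end CRHyp

/-!
The ideal is the span of `e₁, …, e₄`. Let `f₀, …, f₃` be a basis of an ideal `g_{3,1} + g_1` of a
five-dimensional algebra, with `[f₁, f₂] = f₀`. Since `dim_ℝ M = 5`, evaluation at `p` maps the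
algebra isomorphically onto the real tangent space of `M`. If the values of `f₀` and `f₃` at `p`
are complex dependent, then some real combination `b` of them has the value `i f₀(p)`. The
brackets of `f₀` lie in the real span of `f₀` and `f₃`, hence they are complex multiples of `f₀`
at `p`, and differentiating the tangency of `f₀` and `b` shows that `f₀(p)` lies in the kernel of
the Levi form. If they are independent, then `f₁` or `f₂` completes `f₀`, `f₃` to a commuting
frame of `ℂ³`, because otherwise `[f₁, f₂] = f₀` would vanish at `p`. A holomorphic change of
coordinates takes this frame to `i ∂/∂z₁`, `i ∂/∂z₂`, `i ∂/∂z₃`: the hypersurface becomes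
invariant under imaginary translations, that is, a tube. Bracketing twice with the frame maps the
algebra into the real span of the frame, so the second derivatives of the real parts of all fields
vanish on `ℝ³`; these real parts are affine fields tangent to the base of the tube, and they cover
its tangent plane.
-/

namespace CRHyp

/-! ### Osgood's lemma -/

section Osgood

open MeasureTheory Metric Complex
open scoped Real BoundedContinuousFunction

variable {E : Type*} [NormedAddCommGroup E] [NormedSpace ℂ E] {n : ℕ}

theorem norm_torusMap_apply_sub (c : Fin n → ℂ) (R θ : Fin n → ℝ) (i : Fin n) :
    ‖torusMap c R θ i - c i‖ = |R i| := by
  simp [torusMap]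

theorem continuous_torusMap (c : Fin n → ℂ) (R : Fin n → ℝ) : Continuous (torusMap c R) := by
  unfold torusMap
  fun_prop

theorem continuous_torusMap_apply (c : Fin n → ℂ) (R : Fin n → ℝ) (i : Fin n) :
    Continuous fun θ => torusMap c R θ i :=
  (continuous_apply i).comp (continuous_torusMap c R)

theorem torusMap_mem_closedBall (c : Fin n → ℂ) {R : ℝ} (hR : 0 ≤ R) (θ : Fin n → ℝ) :
    torusMap c (fun _ => R) θ ∈ closedBall c R := by
  refine mem_closedBall.2 ((dist_pi_le_iff hR).2 fun i => ?_)
  rw [dist_eq_norm, norm_torusMap_apply_sub, abs_of_nonneg hR]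

theorem sub_dist_le_norm_torusMap_apply_sub (c z : Fin n → ℂ) (R : ℝ) (θ : Fin n → ℝ) (i : Fin n) :
    R - dist z c ≤ ‖torusMap c (fun _ => R) θ i - z i‖ :=
  calc R - dist z c ≤ ‖torusMap c (fun _ => R) θ i - c i‖ - dist (z i) (c i) := by
        rw [norm_torusMap_apply_sub]
        exact sub_le_sub (le_abs_self R) (dist_le_pi_dist z c i)
    _ ≤ ‖torusMap c (fun _ => R) θ i - z i‖ := by
        rw [dist_eq_norm, ← sub_sub_sub_cancel_right _ (z i) (c i)]
        exact norm_sub_norm_le _ _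

theorem torusMap_apply_sub_ne_zero {c z : Fin n → ℂ} {R : ℝ} (hz : z ∈ ball c R)
    (θ : Fin n → ℝ) (i : Fin n) : torusMap c (fun _ => R) θ i - z i ≠ 0 :=
  norm_pos_iff.1 ((sub_pos.2 hz).trans_le (sub_dist_le_norm_torusMap_apply_sub c z R θ i))

theorem cons_mem_closedBall {c : Fin (n + 1) → ℂ} {R : ℝ} (hR : 0 ≤ R) {x : ℂ} {y : Fin n → ℂ}
    (hx : x ∈ closedBall (c 0) R) (hy : y ∈ closedBall (c ∘ Fin.succ) R) :
    (Fin.cons x y : Fin (n + 1) → ℂ) ∈ closedBall c R := by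
  rw [mem_closedBall, dist_pi_le_iff hR] at hy ⊢
  exact Fin.forall_fin_succ.2 ⟨hx, hy⟩

theorem differentiable_finCons {V : Type*} [NormedAddCommGroup V] [NormedSpace ℂ V]
    {f : V → ℂ} {g : V → Fin n → ℂ} (hf : Differentiable ℂ f) (hg : Differentiable ℂ g) :
    Differentiable ℂ fun v => (Fin.cons (f v) (g v) : Fin (n + 1) → ℂ) :=
  differentiable_pi.2 (Fin.forall_fin_succ.2
    ⟨by simpa using hf, fun i => by simpa using differentiable_pi.1 hg i⟩)

theorem torusIntegrable_prod_sub_inv_smul {f : (Fin n → ℂ) → E} {c z : Fin n → ℂ} {R : ℝ}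
    (hf : ContinuousOn f (closedBall c R)) (hz : z ∈ ball c R) :
    TorusIntegrable (fun w => (∏ i, (w i - z i)⁻¹) • f w) c (fun _ => R) := by
  have hR : 0 ≤ R := dist_nonneg.trans hz.le
  refine Continuous.integrableOn_Icc (.smul (continuous_finsetProd _ fun i _ => ?_) ?_)
  · exact ((continuous_torusMap_apply c _ i).sub continuous_const).inv₀ fun θ =>
      torusMap_apply_sub_ne_zero hz θ i
  · exact hf.comp_continuous (continuous_torusMap c _) (torusMap_mem_closedBall c hR)

theorem torusIntegral_prod_sub_inv_smul [CompleteSpace E] {f : (Fin n → ℂ) → E}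
    {c z : Fin n → ℂ} {R : ℝ} (hf : DifferentiableOn ℂ f (closedBall c R)) (hz : z ∈ ball c R) :
    torusIntegral (fun w => (∏ i, (w i - z i)⁻¹) • f w) c (fun _ => R) =
      (2 * π * I : ℂ) ^ n • f z := by
  have hR : 0 < R := dist_nonneg.trans_lt hz
  induction n with
  | zero => simp [Subsingleton.elim c z]
  | succ n ih =>
    have hz0 : z 0 ∈ ball (c 0) R := (dist_le_pi_dist z c 0).trans_lt hz
    have hz' : z ∘ Fin.succ ∈ ball (c ∘ Fin.succ) R :=
      (dist_pi_lt_iff hR).2 fun i => (dist_le_pi_dist z c i.succ).trans_lt hz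
    have integral_tail : ∀ x ∈ sphere (c 0) R,
        torusIntegral (fun y => (∏ i, ((Fin.cons x y : Fin (n + 1) → ℂ) i - z i)⁻¹) •
          f (Fin.cons x y)) (c ∘ Fin.succ) (fun _ => R) =
        (x - z 0)⁻¹ • ((2 * π * I : ℂ) ^ n • f (Fin.cons x (z ∘ Fin.succ))) := by
      intro x hx
      have hd : DifferentiableOn ℂ (fun y => f (Fin.cons x y : Fin (n + 1) → ℂ))
          (closedBall (c ∘ Fin.succ) R) :=
        hf.comp (differentiable_finCons (differentiable_const x) differentiable_id).differentiableOn
          fun y hy => cons_mem_closedBall hR.le (sphere_subset_closedBall hx) hy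
      rw [← ih hd hz', ← torusIntegral_smul]
      simp only [Fin.prod_univ_succ, Fin.cons_zero, Fin.cons_succ, Function.comp_apply, mul_smul]
    have hd : DifferentiableOn ℂ (fun x => (2 * π * I : ℂ) ^ n •
        f (Fin.cons x (z ∘ Fin.succ) : Fin (n + 1) → ℂ)) (closedBall (c 0) R) :=
      .const_smul (hf.comp
        (differentiable_finCons differentiable_id (differentiable_const _)).differentiableOn
        fun x hx => cons_mem_closedBall hR.le hx (ball_subset_closedBall hz')) _
    calc torusIntegral (fun w => (∏ i, (w i - z i)⁻¹) • f w) c (fun _ => R)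
        = ∮ x in C(c 0, R), (x - z 0)⁻¹ •
            ((2 * π * I : ℂ) ^ n • f (Fin.cons x (z ∘ Fin.succ))) := by
          rw [torusIntegral_succ (torusIntegrable_prod_sub_inv_smul hf.continuousOn hz)]
          exact circleIntegral.integral_congr hR.le integral_tail
      _ = (2 * π * I : ℂ) ^ (n + 1) • f (Fin.cons (z 0) (z ∘ Fin.succ)) := by
          rw [hd.circleIntegral_sub_inv_smul hz0, smul_smul, ← pow_succ']
      _ = (2 * π * I : ℂ) ^ (n + 1) • f z := congrArg _ (congrArg f (Fin.cons_self_tail z))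

/-- The `i`-th coordinate of the distinguished boundary of the polydisc `closedBall c R`, as a
bounded continuous function of the angles. Bounded continuous functions form a Banach algebra, so
the Cauchy kernel below is an analytic function of its parameter by general theory. -/
noncomputable def torusCoord (c : Fin n → ℂ) (R : ℝ) (i : Fin n) : (Fin n → ℝ) →ᵇ ℂ :=
  .ofNormedAddCommGroup (fun θ => torusMap c (fun _ => R) θ i) (continuous_torusMap_apply c _ i)
    (‖c i‖ + |R|) fun θ => (norm_add_le _ _).trans_eq (by simp)

theorem isUnit_torusCoord_sub {c z : Fin n → ℂ} {R : ℝ} (hz : z ∈ ball c R) (i : Fin n) :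
    IsUnit (torusCoord c R i - algebraMap ℂ _ (z i)) := by
  let inv : (Fin n → ℝ) →ᵇ ℂ := .ofNormedAddCommGroup
    (fun θ => (torusMap c (fun _ => R) θ i - z i)⁻¹)
    (((continuous_torusMap_apply c _ i).sub continuous_const).inv₀ fun θ =>
      torusMap_apply_sub_ne_zero hz θ i)
    (R - dist z c)⁻¹ fun θ => by
      rw [norm_inv]
      exact inv_anti₀ (sub_pos.2 hz) (sub_dist_le_norm_torusMap_apply_sub c z R θ i)
  exact .of_mul_eq_one inv (BoundedContinuousFunction.ext fun θ =>
    mul_inv_cancel₀ (torusMap_apply_sub_ne_zero hz θ i))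

/-- The Cauchy kernel `∏ i, (w i - z i)⁻¹` of the polydisc `closedBall c R`, as a bounded continuous
function of the angles of `w`; for `z ∉ ball c R` some factors may be the junk value `0`. -/
noncomputable def cauchyKernel (c : Fin n → ℂ) (R : ℝ) (z : Fin n → ℂ) : (Fin n → ℝ) →ᵇ ℂ :=
  ∏ i, Ring.inverse (torusCoord c R i - algebraMap ℂ _ (z i))

theorem cauchyKernel_apply {c z : Fin n → ℂ} {R : ℝ} (hz : z ∈ ball c R) (θ : Fin n → ℝ) :
    cauchyKernel c R z θ = ∏ i, (torusMap c (fun _ => R) θ i - z i)⁻¹ := by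
  rw [cauchyKernel, BoundedContinuousFunction.coe_prod, Finset.prod_apply]
  refine Finset.prod_congr rfl fun i _ => eq_inv_of_mul_eq_one_left ?_
  exact DFunLike.congr_fun (Ring.inverse_mul_cancel _ (isUnit_torusCoord_sub hz i)) θ

theorem analyticAt_cauchyKernel {c z : Fin n → ℂ} {R : ℝ} (hz : z ∈ ball c R) :
    AnalyticAt ℂ (cauchyKernel c R) z := by
  refine Finset.analyticAt_fun_prod _ fun i _ => AnalyticAt.fun_comp
    (analyticAt_inverse (isUnit_torusCoord_sub hz i).unit) (analyticAt_const.sub ?_)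
  let coordConst : (Fin n → ℂ) →L[ℂ] (Fin n → ℝ) →ᵇ ℂ := (algebraMapCLM ℂ _).comp (.proj i)
  exact coordConst.analyticAt z

/-- The functional `g ↦ ∫ x, g x • J x ∂μ` on bounded continuous functions, for integrable `J`. -/
noncomputable def integralSMulCLM {X : Type*} [TopologicalSpace X] [MeasurableSpace X]
    [OpensMeasurableSpace X] {μ : Measure X} {J : X → E} (hJ : Integrable J μ) :
    (X →ᵇ ℂ) →L[ℂ] E :=
  have hint (g : X →ᵇ ℂ) : Integrable (fun x => g x • J x) μ :=
    hJ.bdd_smul ‖g‖ g.continuous.aestronglyMeasurable (.of_forall g.norm_coe_le_norm)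
  LinearMap.mkContinuous
    { toFun := fun g => ∫ x, g x • J x ∂μ
      map_add' := fun g h => by
        simpa only [BoundedContinuousFunction.coe_add, Pi.add_apply, add_smul] using
          integral_add (hint g) (hint h)
      map_smul' := fun a g => by
        simpa only [BoundedContinuousFunction.coe_smul, smul_assoc, RingHom.id_apply] using
          integral_smul a fun x => g x • J x }
    (∫ x, ‖J x‖ ∂μ) fun g =>
      calc ‖∫ x, g x • J x ∂μ‖ ≤ ∫ x, ‖J x‖ * ‖g‖ ∂μ :=
            norm_integral_le_of_norm_le (hJ.norm.mul_const _) <| .of_forall fun x => by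
              rw [norm_smul, mul_comm]
              exact mul_le_mul_of_nonneg_left (g.norm_coe_le_norm x) (norm_nonneg _)
        _ = (∫ x, ‖J x‖ ∂μ) * ‖g‖ := integral_mul_const _ _

theorem analyticAt_of_differentiableOn_closedBall [CompleteSpace E] {f : (Fin n → ℂ) → E}
    {c z : Fin n → ℂ} {R : ℝ} (hf : DifferentiableOn ℂ f (closedBall c R)) (hz : z ∈ ball c R) :
    AnalyticAt ℂ f z := by
  let J : (Fin n → ℝ) → E := fun θ =>
    (∏ i : Fin n, (R : ℂ) * exp (θ i * I) * I : ℂ) • f (torusMap c (fun _ => R) θ)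
  have hJ : IntegrableOn J (Set.Icc 0 fun _ => 2 * π) := by
    refine Continuous.integrableOn_Icc (.smul (by fun_prop) ?_)
    exact hf.continuousOn.comp_continuous (continuous_torusMap c _)
      (torusMap_mem_closedBall c (dist_nonneg.trans hz.le))
  have cauchy : ∀ w ∈ ball c R,
      f w = ((2 * π * I : ℂ) ^ n)⁻¹ • integralSMulCLM hJ (cauchyKernel c R w) := by
    intro w hw
    have hker : integralSMulCLM hJ (cauchyKernel c R w) =
        torusIntegral (fun w' => (∏ i, (w' i - w i)⁻¹) • f w') c (fun _ => R) :=
      integral_congr_ae <| .of_forall fun θ =>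
        (congrArg (· • J θ) (cauchyKernel_apply hw θ)).trans (smul_comm _ _ _)
    rw [hker, torusIntegral_prod_sub_inv_smul hf hw, inv_smul_smul₀ (by simp [Real.pi_ne_zero])]
  have han : AnalyticAt ℂ (fun w => integralSMulCLM hJ (cauchyKernel c R w)) z :=
    ((integralSMulCLM hJ).analyticAt _).comp (analyticAt_cauchyKernel hz)
  refine (han.const_smul (c := ((2 * π * I : ℂ) ^ n)⁻¹)).congr ?_
  filter_upwards [isOpen_ball.mem_nhds hz] with w hw using (cauchy w hw).symm

theorem analyticAt_of_eventually_differentiableAt [CompleteSpace E] {V : Type*}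
    [NormedAddCommGroup V] [NormedSpace ℂ V] [FiniteDimensional ℂ V] {f : V → E} {p : V}
    (hf : ∀ᶠ z in 𝓝 p, DifferentiableAt ℂ f z) : AnalyticAt ℂ f p := by
  let e : V ≃L[ℂ] (Fin (Module.finrank ℂ V) → ℂ) := .ofFinrankEq (by simp)
  have hfe : ∀ᶠ z in 𝓝 (e p), DifferentiableAt ℂ (f ∘ e.symm) z := by
    have hlim : Filter.Tendsto e.symm (𝓝 (e p)) (𝓝 p) :=
      e.symm.continuous.tendsto' _ _ (e.symm_apply_apply p)
    filter_upwards [hlim.eventually hf] with z hz using hz.comp z e.symm.differentiableAt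
  obtain ⟨R, hR, hball⟩ := nhds_basis_closedBall.eventually_iff.1 hfe
  have han : AnalyticAt ℂ (f ∘ e.symm) (e p) := analyticAt_of_differentiableOn_closedBall
    (fun z hz => (hball hz).differentiableWithinAt) (mem_ball_self hR)
  refine (han.comp (e.analyticAt p)).congr (.of_forall fun z => ?_)
  exact congrArg f (e.symm_apply_apply z)

end Osgood

/-! ### Functions vanishing on a regular level set -/

section Vanishing

open Asymptotics Filter

variable {V : Type*} [NormedAddCommGroup V] [NormedSpace ℝ V]
  {W : Type*} [NormedAddCommGroup W] [NormedSpace ℝ W]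

theorem isBigO_sub_of_eq_zero_on_level [CompleteSpace V] {F : Type*} [NormedAddCommGroup F]
    [NormedSpace ℝ F] [FiniteDimensional ℝ F] {f : V → F} {f' : V →L[ℝ] F} {h : V → W}
    {h' : V →L[ℝ] W} {a : V} (hf : HasStrictFDerivAt f f' a) (hf' : f'.range = ⊤)
    (hh : HasStrictFDerivAt h h' a) (hzero : ∀ᶠ x in 𝓝 a, f x = f a → h x = 0) :
    h =O[𝓝 a] fun x => f x - f a := by
  have := FiniteDimensional.complete ℝ F
  let φ := hf.implicitFunctionDataOfComplemented f f' hf'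
    f'.ker_closedComplemented_of_finiteDimensional_range
  let ψ : F × f'.ker → V := fun y => φ.implicitFunction y.1 y.2
  let proj : V → F × f'.ker := fun x => (f a, φ.rightFun x)
  have hψa : ψ (φ.prodFun a) = a := φ.implicitFunction_apply_image.self_of_nhds
  have hprod : Tendsto φ.prodFun (𝓝 a) (𝓝 (φ.prodFun a)) := φ.hasStrictFDerivAt.continuousAt
  have hproj : Tendsto proj (𝓝 a) (𝓝 (φ.prodFun a)) :=
    tendsto_const_nhds.prodMk_nhds φ.hasStrictFDerivAt_rightFun.continuousAt
  have hψ := φ.hasStrictFDerivAt.to_localInverse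
  have hlip : (fun x => h (ψ (φ.prodFun x)) - h (ψ (proj x))) =O[𝓝 a]
      fun x => φ.prodFun x - proj x :=
    (HasStrictFDerivAt.comp (g := h) (g' := h') (f := ψ) (φ.prodFun a) (by rwa [hψa]) hψ).isBigO_sub
      |>.comp_tendsto (hprod.prodMk_nhds hproj)
  have hψproj : ∀ᶠ x in 𝓝 a, h (ψ (proj x)) = 0 := by
    have hlim : Tendsto (ψ ∘ proj) (𝓝 a) (𝓝 a) :=
      (hψ.continuousAt.tendsto.comp hproj).trans_eq (congrArg 𝓝 hψa)
    filter_upwards [φ.leftFun_implicitFunction_eq_leftFun, hlim.eventually hzero]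
      with x hx hzx using hzx hx
  refine (hlip.congr' ?_ .rfl).trans (.of_bound 1 (.of_forall fun x => ?_))
  · filter_upwards [φ.implicitFunction_apply_image, hψproj] with x hx hx0
    rw [hx0, sub_zero]
    exact congrArg h hx
  · simp [φ, proj, ImplicitFunctionData.prodFun_apply]

theorem apply_eq_zero_of_eq_zero_on_level [CompleteSpace V] {f h : V → ℝ} {f' h' : V →L[ℝ] ℝ}
    {a v : V} (hf : HasStrictFDerivAt f f' a) (hf' : f' ≠ 0) (hh : HasStrictFDerivAt h h' a)
    (hzero : ∀ᶠ x in 𝓝 a, f x = f a → h x = 0) (hv : f' v = 0) : h' v = 0 := by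
  have hextr : IsLocalExtrOn h {x | f x = f a} a := by
    refine .inl (eventually_nhdsWithin_iff.2 ?_)
    filter_upwards [hzero] with x hx hxa using (hzero.self_of_nhds rfl).trans_le (hx hxa).ge
  obtain ⟨s, t, hst, hmul⟩ := hextr.exists_multipliers_of_hasStrictFDerivAt_1d hf hh
  have ht : t ≠ 0 := by
    rintro rfl
    exact hst (by simpa [hf'] using hmul)
  simpa [hv, ht] using DFunLike.congr_fun hmul v

theorem eq_zero_of_norm_fderiv_apply_le_mul_norm {f : V → W} {x y : V} {C : ℝ}
    (hf : ∀ z ∈ segment ℝ x y, DifferentiableAt ℝ f z)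
    (hbound : ∀ z ∈ segment ℝ x y, ‖fderiv ℝ f z (y - x)‖ ≤ C * ‖f z‖) (hx : f x = 0) :
    f y = 0 := by
  let γ : ℝ → V := AffineMap.lineMap x y
  have hγ : ∀ t ∈ Set.Icc (0 : ℝ) 1, γ t ∈ segment ℝ x y := fun t ht =>
    segment_eq_image_lineMap ℝ x y ▸ Set.mem_image_of_mem _ ht
  have hder : ∀ t ∈ Set.Icc (0 : ℝ) 1,
      HasDerivAt (fun t => f (γ t)) (fderiv ℝ f (γ t) (y - x)) t := fun t ht =>
    (hf _ (hγ t ht)).hasFDerivAt.comp_hasDerivAt t AffineMap.hasDerivAt_lineMap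
  have hend := eq_zero_of_abs_deriv_le_mul_abs_self_of_eq_zero_right
    (fun t ht => (hder t ht).continuousAt.continuousWithinAt)
    (fun t ht => (hder t (Set.Ico_subset_Icc_self ht)).hasDerivWithinAt)
    (by simpa [γ] using hx) (fun t ht => hbound _ (hγ t (Set.Ico_subset_Icc_self ht)))
    1 (Set.right_mem_Icc.2 zero_le_one)
  simpa [γ] using hend

/-- The derivative of `Φ` along `ι` is a multiple of `Φ`, so that Grönwall's inequality applies
along the segments in the direction of `ι`. -/
theorem eventually_eq_zero_iff_add [CompleteSpace V] {Φ : V → ℝ} {p : V}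
    (hΦ : AnalyticAt ℝ Φ p) (hp : Φ p = 0) (hΦ' : fderiv ℝ Φ p ≠ 0) (ι : W →L[ℝ] V)
    (hzero : ∀ᶠ z in 𝓝 p, Φ z = 0 → ∀ y, fderiv ℝ Φ z (ι y) = 0) :
    ∀ᶠ x : V × W in 𝓝 (p, 0), (Φ x.1 = 0 ↔ Φ (x.1 + ι x.2) = 0) := by
  have hfd : AnalyticAt ℝ (fun z => (fderiv ℝ Φ z).comp ι) p :=
    (((ContinuousLinearMap.compL ℝ W V ℝ).flip ι).analyticAt _).comp hΦ.fderiv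
  have hO : (fun z => (fderiv ℝ Φ z).comp ι) =O[𝓝 p] Φ := by
    simpa only [hp, sub_zero] using isBigO_sub_of_eq_zero_on_level hΦ.hasStrictFDerivAt
      (LinearMap.range_eq_top.2 (LinearMap.surjective (by exact_mod_cast hΦ')))
      hfd.hasStrictFDerivAt (hzero.mono fun z hz h0 =>
        ContinuousLinearMap.ext fun y => hz (h0.trans hp) y)
  obtain ⟨C, hC⟩ := hO.bound
  obtain ⟨r, hr, hball⟩ := Metric.eventually_nhds_iff_ball.1 (hC.and hΦ.eventually_analyticAt)
  have translate : ∀ z ∈ Metric.ball p r, ∀ y, z + ι y ∈ Metric.ball p r → Φ z = 0 →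
      Φ (z + ι y) = 0 := by
    intro z hz y hzy
    have hseg := (convex_ball p r).segment_subset hz hzy
    refine eq_zero_of_norm_fderiv_apply_le_mul_norm (C := C * ‖y‖)
      (fun x hx => (hball x (hseg hx)).2.differentiableAt) fun x hx => ?_
    calc ‖fderiv ℝ Φ x (z + ι y - z)‖ = ‖(fderiv ℝ Φ x).comp ι y‖ := by
          rw [add_sub_cancel_left, ContinuousLinearMap.comp_apply]
      _ ≤ C * ‖Φ x‖ * ‖y‖ := ContinuousLinearMap.le_of_opNorm_le _ (hball x (hseg hx)).1 y
      _ = C * ‖y‖ * ‖Φ x‖ := by ring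
  have hfst : Tendsto Prod.fst (𝓝 (p, (0 : W))) (𝓝 p) := continuousAt_fst
  have hadd : Tendsto (fun x : V × W => x.1 + ι x.2) (𝓝 (p, 0)) (𝓝 p) :=
    (by fun_prop : Continuous fun x : V × W => x.1 + ι x.2).tendsto' _ _ (by simp)
  filter_upwards [hfst.eventually (Metric.ball_mem_nhds p hr),
    hadd.eventually (Metric.ball_mem_nhds p hr)] with x hx hxy
  refine ⟨translate x.1 hx x.2 hxy, fun h0 => ?_⟩
  simpa using translate _ hxy (-x.2) (by simpa using hx) h0

end Vanishing

/-! ### Holomorphic changes of coordinates -/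

section Invertible

variable {𝕜 : Type*} [NontriviallyNormedField 𝕜] {V : Type*} [NormedAddCommGroup V]
  [NormedSpace 𝕜 V] {W : Type*} [NormedAddCommGroup W] [NormedSpace 𝕜 W]

theorem eventually_isInvertible [CompleteSpace V] {X : Type*} [TopologicalSpace X]
    {A : X → V →L[𝕜] W} {p : X} (hA : ContinuousAt A p) (hAp : (A p).IsInvertible) :
    ∀ᶠ z in 𝓝 p, (A z).IsInvertible :=
  hA.eventually_mem (ContinuousLinearEquiv.isOpen.mem_nhds hAp)

theorem contDiffAt_inverse_apply [CompleteSpace V] {E : Type*} [NormedAddCommGroup E]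
    [NormedSpace 𝕜 E] {A : E → V →L[𝕜] W} {p : E} (hA : ContDiffAt 𝕜 ⊤ A p)
    (hAp : (A p).IsInvertible) : ContDiffAt 𝕜 ⊤ (fun z => (A z).inverse) p :=
  hAp.contDiffAt_map_inverse.comp p hA

theorem isInvertible_fderiv_of_mem_source {F : OpenPartialHomeomorph V W} {p : V}
    (hp : p ∈ F.source) (hF : DifferentiableAt 𝕜 F p)
    (hFsymm : DifferentiableAt 𝕜 F.symm (F p)) : (fderiv 𝕜 F p).IsInvertible := by
  have hleft : HasFDerivAt (F.symm ∘ F) ((fderiv 𝕜 F.symm (F p)).comp (fderiv 𝕜 F p)) p :=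
    hFsymm.hasFDerivAt.comp p hF.hasFDerivAt
  have hright : HasFDerivAt (F ∘ F.symm) ((fderiv 𝕜 F p).comp (fderiv 𝕜 F.symm (F p))) (F p) :=
    HasFDerivAt.comp (F p) (by rw [F.left_inv hp]; exact hF.hasFDerivAt) hFsymm.hasFDerivAt
  refine .of_inverse (g := fderiv 𝕜 F.symm (F p)) ?_ ?_
  · exact hright.unique ((hasFDerivAt_id (F p)).congr_of_eventuallyEq
      (F.eventually_right_inverse' hp))
  · exact hleft.unique ((hasFDerivAt_id p).congr_of_eventuallyEq (F.eventually_left_inverse hp))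

end Invertible

section ChangeOfCoordinates

variable {V : Type*} [NormedAddCommGroup V] [NormedSpace ℝ V] [NormedSpace ℂ V]
  [IsScalarTower ℝ ℂ V] {W : Type*} [NormedAddCommGroup W] [NormedSpace ℝ W] [NormedSpace ℂ W]
  [IsScalarTower ℝ ℂ W]

theorem fderiv_comp_holomorphic_apply {Ψ : W → ℝ} {F : V → W} {z : V}
    (hΨ : DifferentiableAt ℝ Ψ (F z)) (hF : DifferentiableAt ℂ F z) (v : V) :
    fderiv ℝ (Ψ ∘ F) z v = fderiv ℝ Ψ (F z) (fderiv ℂ F z v) :=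
  DFunLike.congr_fun (hΨ.hasFDerivAt.comp z (hF.hasFDerivAt.restrictScalars ℝ)).fderiv v

theorem IsDefiningFunctionAt.comp_holomorphic {Ψ : W → ℝ} {F : V → W} {p : V} {M : Set V}
    {N : Set W} (hΨ : IsDefiningFunctionAt Ψ N (F p)) (hF : AnalyticAt ℂ F p)
    (hF' : (fderiv ℂ F p).IsInvertible) (hMN : ∀ᶠ z in 𝓝 p, (z ∈ M ↔ F z ∈ N)) :
    IsDefiningFunctionAt (Ψ ∘ F) M p where
  analyticAt := hΨ.analyticAt.comp hF.restrictScalars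
  map_eq_zero := hΨ.map_eq_zero
  fderiv_ne_zero h := hΨ.fderiv_ne_zero <| ContinuousLinearMap.ext fun w => by
    obtain ⟨v, rfl⟩ := hF'.bijective.surjective w
    rw [← fderiv_comp_holomorphic_apply hΨ.analyticAt.differentiableAt hF.differentiableAt, h]
    rfl
  mem_iff := by
    filter_upwards [hMN, hF.continuousAt.eventually hΨ.mem_iff] with z hz hFz
    exact hz.trans hFz

end ChangeOfCoordinates

/-! ### The Levi form in holomorphic coordinates -/

section Levi

variable {Ψ : C3 → ℝ} {F : C3 → C3} {p : C3} {M N : Set C3} {q : C3}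

theorem hess_eq_fderiv_fderiv_apply {Φ : C3 → ℝ} (hΦ : AnalyticAt ℝ Φ p) (v w : C3) :
    hess Φ p v w = fderiv ℝ (fun z => fderiv ℝ Φ z w) p v := by
  rw [hess, (hΦ.fderiv.differentiableAt.hasFDerivAt.clm_apply (hasFDerivAt_const w p)).fderiv]
  simp

theorem hess_comm {Φ : C3 → ℝ} (hΦ : AnalyticAt ℝ Φ p) (v w : C3) :
    hess Φ p v w = hess Φ p w v :=
  (hΦ.contDiffAt (n := ⊤)).isSymmSndFDerivAt (by simp) v w

theorem hess_comp_holomorphic (hΨ : AnalyticAt ℝ Ψ (F p)) (hF : AnalyticAt ℂ F p) (v w : C3) :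
    hess (Ψ ∘ F) p v w = hess Ψ (F p) (fderiv ℂ F p v) (fderiv ℂ F p w) +
      fderiv ℝ Ψ (F p) (fderiv ℂ (fderiv ℂ F) p v w) := by
  have hdir : (fun z => fderiv ℝ (Ψ ∘ F) z w) =ᶠ[𝓝 p]
      fun z => fderiv ℝ Ψ (F z) (fderiv ℂ F z w) := by
    filter_upwards [hF.continuousAt.eventually hΨ.eventually_analyticAt, hF.eventually_analyticAt]
      with z hz hz'
    exact fderiv_comp_holomorphic_apply hz.differentiableAt hz'.differentiableAt w
  have hF' : HasFDerivAt (fun z => fderiv ℂ F z w)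
      (((fderiv ℂ (fderiv ℂ F) p).flip w).restrictScalars ℝ) p := by
    refine HasFDerivAt.restrictScalars ℝ ?_
    simpa using hF.fderiv.differentiableAt.hasFDerivAt.clm_apply (hasFDerivAt_const w p)
  have hΨ' : HasFDerivAt (fun z => fderiv ℝ Ψ (F z))
      ((fderiv ℝ (fderiv ℝ Ψ) (F p)).comp ((fderiv ℂ F p).restrictScalars ℝ)) p :=
    hΨ.fderiv.differentiableAt.hasFDerivAt.comp p
      (hF.differentiableAt.hasFDerivAt.restrictScalars ℝ)
  rw [hess_eq_fderiv_fderiv_apply (hΨ.comp hF.restrictScalars), hdir.fderiv_eq,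
    (hΨ'.clm_apply hF').fderiv]
  simp [hess, add_comm]

/-- The term with the second derivative of `F` drops out because it is complex bilinear. -/
theorem leviForm_comp_holomorphic (hΨ : AnalyticAt ℝ Ψ (F p)) (hF : AnalyticAt ℂ F p)
    (v w : C3) :
    leviForm (Ψ ∘ F) p v w = leviForm Ψ (F p) (fderiv ℂ F p v) (fderiv ℂ F p w) := by
  simp only [leviForm, hess_comp_holomorphic hΨ hF, map_smul, smul_apply,
    smul_smul, Complex.I_mul_I, neg_smul, one_smul, map_neg]
  push_cast
  ring

theorem isComplexTangent_comp_holomorphic_iff (hΨ : AnalyticAt ℝ Ψ (F p))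
    (hF : AnalyticAt ℂ F p) (v : C3) :
    IsComplexTangent (Ψ ∘ F) p v ↔ IsComplexTangent Ψ (F p) (fderiv ℂ F p v) := by
  simp only [IsComplexTangent,
    fderiv_comp_holomorphic_apply hΨ.differentiableAt hF.differentiableAt, map_smul]

theorem HasLeviKernel.comp_holomorphic (hΨ : AnalyticAt ℝ Ψ (F p)) (hF : AnalyticAt ℂ F p)
    (hF' : (fderiv ℂ F p).IsInvertible) (h : HasLeviKernel Ψ (F p)) :
    HasLeviKernel (Ψ ∘ F) p := by
  obtain ⟨u, hu, hut, hker⟩ := h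
  obtain ⟨v, rfl⟩ := hF'.bijective.surjective u
  refine ⟨v, fun h0 => hu (by rw [h0, map_zero]),
    (isComplexTangent_comp_holomorphic_iff hΨ hF v).2 hut, fun w hw => ?_⟩
  rw [leviForm_comp_holomorphic hΨ hF]
  exact hker _ ((isComplexTangent_comp_holomorphic_iff hΨ hF w).1 hw)

theorem LeviDegenerateAt.of_holomorphicallyEquivalentAt (hN : LeviDegenerateAt N q)
    (h : HolomorphicallyEquivalentAt M p N q) : LeviDegenerateAt M p := by
  obtain ⟨F, hp, rfl, hF, hFsymm, hMN⟩ := h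
  obtain ⟨Ψ, hΨ, hker⟩ := hN
  have hsource : F.source ∈ 𝓝 p := F.open_source.mem_nhds hp
  have hFp : AnalyticAt ℂ F p := analyticAt_of_eventually_differentiableAt <| by
    filter_upwards [F.open_source.eventually_mem hp] with z hz
    exact hF.differentiableAt (F.open_source.mem_nhds hz)
  have hF' : (fderiv ℂ F p).IsInvertible := isInvertible_fderiv_of_mem_source hp
    hFp.differentiableAt (hFsymm.differentiableAt (F.open_target.mem_nhds (F.map_source hp)))
  exact ⟨Ψ ∘ F, hΨ.comp_holomorphic hFp hF' (Filter.eventually_of_mem hsource hMN),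
    hker.comp_holomorphic hΨ.analyticAt hFp hF'⟩

end Levi

/-! ### Realizations by holomorphic vector fields -/

section Realization

variable {V : Type*} [NormedAddCommGroup V] [NormedSpace ℝ V] [NormedSpace ℂ V]
  {L : Type*} [LieRing L] [LieAlgebra ℝ L]

/-- `ρ` is a realization of the Lie algebra `L` by germs at `p` of holomorphic vector fields that
are tangent to the hypersurface `M = {Φ = 0}` and whose values at `p` cover its tangent space. -/
structure IsRealizationAt (Φ : V → ℝ) (M : Set V) (p : V) (ρ : L →ₗ[ℝ] V → V) : Prop where
  defining : IsDefiningFunctionAt Φ M p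
  eventually_analyticAt : ∀ᶠ z in 𝓝 p, ∀ X, AnalyticAt ℂ (ρ X) z
  map_lie : ∀ᶠ z in 𝓝 p, ∀ X Y, ρ ⁅X, Y⁆ z = VectorField.lieBracket ℂ (ρ X) (ρ Y) z
  tangent : ∀ᶠ z in 𝓝 p, Φ z = 0 → ∀ X, fderiv ℝ Φ z (ρ X z) = 0
  transitive : ∀ v, fderiv ℝ Φ p v = 0 → ∃ X, ρ X p = v

theorem IsAssociatedWith.exists_isRealizationAt {M : Set C3} {p : C3}
    (h : IsAssociatedWith M p L) : ∃ Φ, ∃ ρ : L →ₗ[ℝ] C3 → C3, IsRealizationAt Φ M p ρ := by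
  obtain ⟨Φ, hΦ, U, ρ, hU, hp, hρ, hlie, htangent, htrans⟩ := h
  refine ⟨Φ, ρ, hΦ, ?_, ?_, ?_, htrans⟩
  · filter_upwards [hU.eventually_mem hp] with z hz X
    exact analyticAt_of_eventually_differentiableAt <| by
      filter_upwards [hU.eventually_mem hz] with w hw
      exact (hρ X).differentiableAt (hU.mem_nhds hw)
  · filter_upwards [hU.eventually_mem hp] with z hz X Y
    exact hlie X Y z hz
  · filter_upwards [hU.eventually_mem hp, hΦ.mem_iff] with z hz hzM h0 X
    exact htangent X z ⟨hzM.2 h0, hz⟩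

theorem apply_complex_smul [IsScalarTower ℝ ℂ V] (l : V →L[ℝ] ℝ) (c : ℂ) (v : V) :
    l (c • v) = c.re * l v + c.im * l (Complex.I • v) := by
  have hc : c • v = c.re • v + c.im • Complex.I • v := by
    rw [← algebraMap_smul ℂ c.re, ← algebraMap_smul ℂ c.im, smul_smul, ← add_smul]
    exact congrArg (· • v) (Complex.re_add_im c).symm
  rw [hc, map_add, map_smul, map_smul, smul_eq_mul, smul_eq_mul]

namespace IsRealizationAt

variable {Φ : V → ℝ} {M : Set V} {p : V} {ρ : L →ₗ[ℝ] V → V}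

theorem analyticAt (h : IsRealizationAt Φ M p ρ) (X : L) : AnalyticAt ℂ (ρ X) p :=
  h.eventually_analyticAt.self_of_nhds X

theorem map_lie_apply (h : IsRealizationAt Φ M p ρ) (X Y : L) :
    ρ ⁅X, Y⁆ p = fderiv ℂ (ρ Y) p (ρ X p) - fderiv ℂ (ρ X) p (ρ Y p) :=
  h.map_lie.self_of_nhds X Y

theorem fderiv_apply_eq_zero (h : IsRealizationAt Φ M p ρ) (X : L) :
    fderiv ℝ Φ p (ρ X p) = 0 :=
  h.tangent.self_of_nhds h.defining.map_eq_zero X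

theorem fderiv_fderiv_apply_comm (h : IsRealizationAt Φ M p ρ) (X Y : L) :
    fderiv ℝ Φ p (fderiv ℂ (ρ X) p (ρ Y p)) = fderiv ℝ Φ p (fderiv ℂ (ρ Y) p (ρ X p)) := by
  have hlie := h.fderiv_apply_eq_zero ⁅X, Y⁆
  rw [h.map_lie_apply, map_sub, sub_eq_zero] at hlie
  exact hlie.symm

theorem eq_zero_of_apply_eq_zero [FiniteDimensional ℝ L] [FiniteDimensional ℝ V]
    (h : IsRealizationAt Φ M p ρ) (hL : Module.finrank ℝ L + 1 = Module.finrank ℝ V) {X : L}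
    (hX : ρ X p = 0) : X = 0 := by
  let T := (fderiv ℝ Φ p).toLinearMap.ker
  let eval : L →ₗ[ℝ] T := (LinearMap.proj p ∘ₗ ρ).codRestrict T h.fderiv_apply_eq_zero
  have hne : (fderiv ℝ Φ p).toLinearMap ≠ 0 := fun h0 => h.defining.fderiv_ne_zero <|
    ContinuousLinearMap.coe_injective h0
  have hT : Module.finrank ℝ L = Module.finrank ℝ T := Nat.succ_injective <|
    hL.trans (Module.Dual.finrank_ker_add_one_of_ne_zero hne).symm
  have hsurj : Function.Surjective eval := fun ⟨v, hv⟩ =>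
    (h.transitive v hv).imp fun X hX => Subtype.ext hX
  have hinj : Function.Injective eval :=
    (LinearMap.injective_iff_surjective_of_finrank_eq_finrank hT).2 hsurj
  exact (injective_iff_map_eq_zero eval).1 hinj X (Subtype.ext hX)

/-- Two commuting fields `a`, `d` cannot span, over `ℂ` and at `p`, a pair of fields whose bracket
is `a`: writing `x` and `y` in terms of `a` and `d` at `p` forces `⁅x, y⁆` to vanish there. -/
theorem notMem_span_pair (h : IsRealizationAt Φ M p ρ) {a d x y : L} (hxy : ⁅x, y⁆ = a)
    (hax : ⁅a, x⁆ = 0) (hay : ⁅a, y⁆ = 0) (had : ⁅a, d⁆ = 0) (hxd : ⁅x, d⁆ = 0)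
    (hyd : ⁅y, d⁆ = 0) (ha : ρ a p ≠ 0) :
    ρ x p ∉ Submodule.span ℂ {ρ a p, ρ d p} ∨ ρ y p ∉ Submodule.span ℂ {ρ a p, ρ d p} := by
  by_contra! hmem
  obtain ⟨⟨α, β, hx⟩, γ, δ, hy⟩ := hmem.imp Submodule.mem_span_pair.1 Submodule.mem_span_pair.1
  have fderiv_comm : ∀ {X Y : L}, ⁅X, Y⁆ = 0 →
      fderiv ℂ (ρ Y) p (ρ X p) = fderiv ℂ (ρ X) p (ρ Y p) := fun {X Y} hXY => by
    have hlie := h.map_lie_apply X Y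
    rw [hXY, map_zero] at hlie
    exact sub_eq_zero.1 hlie.symm
  have hDy : fderiv ℂ (ρ y) p (ρ x p) =
      α • fderiv ℂ (ρ a) p (ρ y p) + β • fderiv ℂ (ρ d) p (ρ y p) := by
    rw [← fderiv_comm hay, fderiv_comm hyd, ← hx, map_add, map_smul, map_smul]
  have hDx : fderiv ℂ (ρ x) p (ρ y p) =
      γ • fderiv ℂ (ρ a) p (ρ x p) + δ • fderiv ℂ (ρ d) p (ρ x p) := by
    rw [← fderiv_comm hax, fderiv_comm hxd, ← hy, map_add, map_smul, map_smul]
  refine ha ?_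
  rw [← hxy, h.map_lie_apply, hDx, hDy, ← hx, ← hy]
  simp only [map_add, map_smul, fderiv_comm had]
  module

end IsRealizationAt

end Realization

section LeviDegeneracy

variable {L : Type*} [LieRing L] [LieAlgebra ℝ L] {Φ : C3 → ℝ} {M : Set C3} {p : C3}
  {ρ : L →ₗ[ℝ] C3 → C3}

namespace IsRealizationAt

theorem hess_apply_eq (h : IsRealizationAt Φ M p ρ) (X : L) {w : C3}
    (hw : fderiv ℝ Φ p w = 0) :
    hess Φ p (ρ X p) w = -fderiv ℝ Φ p (fderiv ℂ (ρ X) p w) := by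
  have hΦ := h.defining.analyticAt
  have hstrict : HasStrictFDerivAt (fun z => fderiv ℝ Φ z (ρ X z)) _ p :=
    hΦ.fderiv.hasStrictFDerivAt.clm_apply ((h.analyticAt X).hasStrictFDerivAt.restrictScalars ℝ)
  have hderiv := apply_eq_zero_of_eq_zero_on_level hΦ.hasStrictFDerivAt
    h.defining.fderiv_ne_zero hstrict (by
      filter_upwards [h.tangent] with z hz h0
      exact hz (h0.trans h.defining.map_eq_zero) X) hw
  rw [hess_comm hΦ, eq_neg_iff_add_eq_zero, hess, ← hderiv]
  simp [add_comm]

theorem hess_add_hess_I_smul_eq_zero (h : IsRealizationAt Φ M p ρ) {a b : L}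
    (hb : ρ b p = Complex.I • ρ a p) (hline : ∀ Z, ∃ α : ℂ, ρ ⁅a, Z⁆ p = α • ρ a p) {w : C3}
    (hw : IsComplexTangent Φ p w) :
    hess Φ p (ρ a p) w + hess Φ p (Complex.I • ρ a p) (Complex.I • w) = 0 := by
  obtain ⟨Y, hY⟩ := h.transitive _ hw.2
  obtain ⟨α, hα⟩ := hline Y
  rw [h.map_lie_apply, hY, map_smul, sub_eq_iff_eq_add] at hα
  have hdΦ : fderiv ℝ Φ p ((Complex.I * α) • ρ a p) = 0 := by
    rw [apply_complex_smul, ← hb, h.fderiv_apply_eq_zero, h.fderiv_apply_eq_zero, mul_zero,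
      mul_zero, add_zero]
  have hDY : fderiv ℂ (ρ Y) p (ρ b p) = (Complex.I * α) • ρ a p - fderiv ℂ (ρ a) p w := by
    rw [hb, map_smul, hα, smul_add, smul_smul, smul_smul, Complex.I_mul_I, neg_one_smul,
      sub_eq_add_neg]
  rw [← hb, h.hess_apply_eq a hw.1, h.hess_apply_eq b hw.2, ← hY, h.fderiv_fderiv_apply_comm,
    hDY, map_sub, hdΦ]
  ring

theorem leviDegenerateAt (h : IsRealizationAt Φ M p ρ) {a b : L} (ha : ρ a p ≠ 0)
    (hb : ρ b p = Complex.I • ρ a p) (hline : ∀ Z, ∃ α : ℂ, ρ ⁅a, Z⁆ p = α • ρ a p) :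
    LeviDegenerateAt M p := by
  refine ⟨Φ, h.defining, ρ a p, ha,
    ⟨h.fderiv_apply_eq_zero a, by rw [← hb]; exact h.fderiv_apply_eq_zero b⟩, fun w hw => ?_⟩
  have hII : Complex.I • Complex.I • w = -w := by
    rw [smul_smul, Complex.I_mul_I, neg_one_smul]
  have hIw : IsComplexTangent Φ p (Complex.I • w) :=
    ⟨hw.2, by rw [hII, map_neg, hw.1, neg_zero]⟩
  have hre := h.hess_add_hess_I_smul_eq_zero hb hline hw
  have him := h.hess_add_hess_I_smul_eq_zero hb hline hIw
  have hneg : hess Φ p (Complex.I • ρ a p) (-w) = -hess Φ p (Complex.I • ρ a p) w :=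
    map_neg _ _
  rw [hII, hneg, ← sub_eq_add_neg] at him
  rw [leviForm, hre, him, Complex.ofReal_zero, mul_zero, add_zero, mul_zero]

end IsRealizationAt

end LeviDegeneracy

/-! ### Pulling back realizations -/

section Pullback

variable {V W : Type*} [NormedAddCommGroup V] [NormedSpace ℝ V] [NormedSpace ℂ V]
  [IsScalarTower ℝ ℂ V] [NormedAddCommGroup W] [NormedSpace ℝ W]
  [NormedSpace ℂ W] [IsScalarTower ℝ ℂ W]
  {L : Type*} [LieRing L] [LieAlgebra ℝ L]

/-- The pullback of holomorphic vector fields along `G`, as a real linear map. -/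
noncomputable def pullbackField (G : W → V) : (V → V) →ₗ[ℝ] W → W where
  toFun X := VectorField.pullback ℂ G X
  map_add' _ _ := funext fun _ => map_add _ _ _
  map_smul' c _ := funext fun ζ => ((fderiv ℂ G ζ).inverse.restrictScalars ℝ).map_smul c _

theorem pullbackField_apply_eq {G : W → V} {X : V → V} {ζ w : W}
    (hG : (fderiv ℂ G ζ).IsInvertible) (hw : fderiv ℂ G ζ w = X (G ζ)) :
    pullbackField G X ζ = w :=
  hG.inverse_apply_eq.2 hw.symm

theorem fderiv_pullbackField_apply {G : W → V} (X : V → V) {ζ : W}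
    (hG : (fderiv ℂ G ζ).IsInvertible) : fderiv ℂ G ζ (pullbackField G X ζ) = X (G ζ) :=
  VectorField.fderiv_pullback G X ζ hG

theorem analyticAt_pullbackField [CompleteSpace V] [CompleteSpace W] {G : W → V} {X : V → V}
    {q : W}
    (hG : AnalyticAt ℂ G q) (hG' : (fderiv ℂ G q).IsInvertible) (hX : AnalyticAt ℂ X (G q)) :
    AnalyticAt ℂ (pullbackField G X) q :=
  ((contDiffAt_inverse_apply hG.fderiv.contDiffAt hG').clm_apply
    (hX.comp hG).contDiffAt).analyticAt

theorem IsRealizationAt.pullback [CompleteSpace V] [CompleteSpace W] {Φ : V → ℝ} {M : Set V}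
    {ρ : L →ₗ[ℝ] V → V} {G : W → V} {q : W}
    (h : IsRealizationAt Φ M (G q) ρ) (hG : AnalyticAt ℂ G q)
    (hG' : (fderiv ℂ G q).IsInvertible) :
    IsRealizationAt (Φ ∘ G) (G ⁻¹' M) q (pullbackField G ∘ₗ ρ) := by
  have hGan := hG.eventually_analyticAt
  have hGinv : ∀ᶠ ζ in 𝓝 q, (fderiv ℂ G ζ).IsInvertible :=
    eventually_isInvertible hG.fderiv.continuousAt hG'
  refine ⟨h.defining.comp_holomorphic hG hG' (.of_forall fun _ => Iff.rfl), ?_, ?_, ?_, ?_⟩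
  · filter_upwards [hGan, hGinv, hG.continuousAt.eventually h.eventually_analyticAt]
      with ζ hζ hζ' hρ X
    exact analyticAt_pullbackField hζ hζ' (hρ X)
  · filter_upwards [hGan, hG.continuousAt.eventually h.eventually_analyticAt,
      hG.continuousAt.eventually h.map_lie] with ζ hζ hρ hlie X Y
    have hpull := VectorField.pullback_lieBracket (n := ⊤) le_top hζ.contDiffAt
      (hρ X).differentiableAt (hρ Y).differentiableAt
    exact (congrArg (fderiv ℂ G ζ).inverse (hlie X Y)).trans hpull
  · filter_upwards [hGan, hGinv, hG.continuousAt.eventually h.tangent,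
      hG.continuousAt.eventually h.defining.analyticAt.eventually_analyticAt]
      with ζ hζ hζ' htangent hΦ h0 X
    rw [fderiv_comp_holomorphic_apply hΦ.differentiableAt hζ.differentiableAt]
    exact (congrArg _ (fderiv_pullbackField_apply _ hζ')).trans (htangent h0 X)
  · intro v hv
    rw [fderiv_comp_holomorphic_apply h.defining.analyticAt.differentiableAt
      hG.differentiableAt] at hv
    obtain ⟨X, hX⟩ := h.transitive _ hv
    exact ⟨X, pullbackField_apply_eq hG' hX.symm⟩

end Pullback

/-! ### Straightening commuting fields -/

section Straightening

variable {V : Type*} [NormedAddCommGroup V] [NormedSpace ℂ V]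

section ClosedForm

variable {W : Type*} [NormedAddCommGroup W] [NormedSpace ℂ W] [CompleteSpace W]
  {A : V → W →L[ℂ] V} {p : V}

theorem apply_fderiv_inverse_apply [CompleteSpace V] (hA : AnalyticAt ℂ A p)
    (hAp : (A p).IsInvertible) (u : V) (w : W) :
    A p (fderiv ℂ (fun z => (A z).inverse) p u (A p w)) = -fderiv ℂ A p u w := by
  have hconst : (fun z => A z ((A z).inverse (A p w))) =ᶠ[𝓝 p] fun _ => A p w := by
    filter_upwards [eventually_isInvertible hA.continuousAt hAp] with z hz
    exact hz.self_apply_inverse _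
  have hinv : HasFDerivAt (fun z => (A z).inverse (A p w))
      ((fderiv ℂ (fun z => (A z).inverse) p).flip (A p w)) p := by
    have hdiff := (contDiffAt_inverse_apply hA.contDiffAt hAp).differentiableAt (by simp)
    simpa using hdiff.hasFDerivAt.clm_apply (hasFDerivAt_const (A p w) p)
  have hzero := DFunLike.congr_fun ((hA.differentiableAt.hasFDerivAt.clm_apply hinv).unique
    ((hasFDerivAt_const (A p w) p).congr_of_eventuallyEq hconst)) u
  rw [eq_neg_iff_add_eq_zero]
  simpa [hAp.inverse_apply_self] using hzero

/-- The hypothesis says that the vector fields `z ↦ A z w` commute; equivalently, the 1-form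
`z ↦ (A z)⁻¹` is closed. -/
theorem exists_eventually_hasFDerivAt_inverse [CompleteSpace V] (hA : AnalyticAt ℂ A p)
    (hAp : (A p).IsInvertible)
    (hcomm : ∀ᶠ z in 𝓝 p, ∀ w w', fderiv ℂ A z (A z w) w' = fderiv ℂ A z (A z w') w) :
    ∃ f : V → W, f p = 0 ∧ ∀ᶠ z in 𝓝 p, HasFDerivAt f (A z).inverse z := by
  let : NormedSpace ℝ V := NormedSpace.restrictScalars ℝ ℂ V
  let : NormedSpace ℝ W := NormedSpace.restrictScalars ℝ ℂ W
  obtain ⟨r, hr, hball⟩ := Metric.mem_nhds_iff.1 (hA.eventually_analyticAt.and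
    ((eventually_isInvertible hA.continuousAt hAp).and hcomm))
  have hω : ∀ z ∈ Metric.ball p r, DifferentiableAt ℂ (fun z => (A z).inverse) z := fun z hz =>
    (contDiffAt_inverse_apply (hball hz).1.contDiffAt (hball hz).2.1).differentiableAt (by simp)
  have hclosed : ∀ z ∈ Metric.ball p r, ∀ u v,
      fderiv ℂ (fun z => (A z).inverse) z u v = fderiv ℂ (fun z => (A z).inverse) z v u := by
    intro z hz u v
    obtain ⟨hAz, hinv, hsymm⟩ := hball hz
    obtain ⟨w, rfl⟩ := hinv.bijective.surjective u
    obtain ⟨w', rfl⟩ := hinv.bijective.surjective v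
    refine hinv.bijective.injective ?_
    rw [apply_fderiv_inverse_apply hAz hinv, apply_fderiv_inverse_apply hAz hinv, hsymm]
  obtain ⟨f, hf⟩ := (convex_ball p r).exists_forall_hasFDerivAt_of_fderiv_symmetric
    Metric.isOpen_ball (fun z hz => ((hω z hz).restrictScalars ℝ).differentiableWithinAt)
    (fun z hz u v => by
      rw [(hω z hz).fderiv_restrictScalars ℝ]
      exact hclosed z hz u v)
  exact ⟨fun z => f z - f p, sub_self _, Filter.mem_of_superset (Metric.ball_mem_nhds p hr)
    fun z hz => (hf z hz).sub_const _⟩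

theorem exists_openPartialHomeomorph_hasFDerivAt_symm [FiniteDimensional ℂ V]
    (hA : AnalyticAt ℂ A p) (hAp : (A p).IsInvertible)
    (hcomm : ∀ᶠ z in 𝓝 p, ∀ w w', fderiv ℂ A z (A z w) w' = fderiv ℂ A z (A z w') w) :
    ∃ F : OpenPartialHomeomorph V W, p ∈ F.source ∧ F p = 0 ∧
      DifferentiableOn ℂ F F.source ∧ ∀ ζ ∈ F.target, HasFDerivAt F.symm (A (F.symm ζ)) ζ := by
  have := FiniteDimensional.complete ℂ V
  obtain ⟨f, hfp, hf⟩ := exists_eventually_hasFDerivAt_inverse hA hAp hcomm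
  obtain ⟨s, hs, hso, hps⟩ :=
    eventually_nhds_iff.1 (hf.and (eventually_isInvertible hA.continuousAt hAp))
  have hfan : AnalyticAt ℂ f p :=
    analyticAt_of_eventually_differentiableAt (hf.mono fun _ hz => hz.differentiableAt)
  obtain ⟨e, he⟩ := hAp
  have hstrict : HasStrictFDerivAt f (e.symm : V →L[ℂ] W) p := by
    have hderiv := hf.self_of_nhds.fderiv
    rw [← he, ContinuousLinearMap.inverse_equiv] at hderiv
    exact hderiv ▸ hfan.hasStrictFDerivAt
  refine ⟨(hstrict.toOpenPartialHomeomorph f).restrOpen s hso,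
    ⟨hstrict.mem_toOpenPartialHomeomorph_source, hps⟩, hfp,
    fun z hz => (hs z hz.2).1.differentiableAt.differentiableWithinAt, fun ζ hζ => ?_⟩
  obtain ⟨hfζ, eζ, heζ⟩ := hs _ (OpenPartialHomeomorph.map_target _ hζ).2
  rw [← heζ, ContinuousLinearMap.inverse_equiv] at hfζ
  rw [← heζ, ← eζ.symm_symm]
  exact OpenPartialHomeomorph.hasFDerivAt_symm _ hζ hfζ

end ClosedForm

section Frame

variable {ι : Type*} [Fintype ι] {X : ι → V → V} {p : V}

/-- The complex linear map `c ↦ ∑ j, c j • X j z` given by a tuple `X` of vector fields at `z`. -/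
noncomputable def fieldFrame (X : ι → V → V) (z : V) : (ι → ℂ) →L[ℂ] V :=
  ∑ j, (ContinuousLinearMap.proj (R := ℂ) (φ := fun _ : ι => ℂ) j).smulRight (X j z)

theorem fieldFrame_apply (X : ι → V → V) (z : V) (c : ι → ℂ) :
    fieldFrame X z c = ∑ j, c j • X j z := by
  simp [fieldFrame]

theorem analyticAt_fieldFrame (hX : ∀ j, AnalyticAt ℂ (X j) p) :
    AnalyticAt ℂ (fieldFrame X) p := by
  refine Finset.analyticAt_fun_sum _ fun j _ => ?_
  exact ((ContinuousLinearMap.smulRightL ℂ (ι → ℂ) V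
    (ContinuousLinearMap.proj (R := ℂ) (φ := fun _ : ι => ℂ) j)).analyticAt _).comp (hX j)

theorem fderiv_fieldFrame_apply (hX : ∀ j, AnalyticAt ℂ (X j) p) (u : V) (c : ι → ℂ) :
    fderiv ℂ (fieldFrame X) p u c = ∑ j, c j • fderiv ℂ (X j) p u := by
  have hframe : HasFDerivAt (fun z => fieldFrame X z c) ((fderiv ℂ (fieldFrame X) p).flip c) p := by
    simpa using (analyticAt_fieldFrame hX).differentiableAt.hasFDerivAt.clm_apply
      (hasFDerivAt_const c p)
  have hsum : HasFDerivAt (fun z => fieldFrame X z c) (∑ j, c j • fderiv ℂ (X j) p) p := by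
    simp only [fieldFrame_apply]
    exact .fun_sum fun j _ => (hX j).differentiableAt.hasFDerivAt.const_smul (c j)
  simpa using DFunLike.congr_fun (hframe.unique hsum) u

theorem isInvertible_fieldFrame [FiniteDimensional ℂ V]
    (hcard : Fintype.card ι = Module.finrank ℂ V) (hli : LinearIndependent ℂ fun j => X j p) :
    (fieldFrame X p).IsInvertible := by
  have hinj : Function.Injective (fieldFrame X p) := by
    rw [injective_iff_map_eq_zero]
    intro c hc
    rw [fieldFrame_apply] at hc
    exact funext (Fintype.linearIndependent_iff.1 hli c hc)
  have hrank : Module.finrank ℂ (ι → ℂ) = Module.finrank ℂ V := by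
    rw [Module.finrank_fintype_fun_eq_card, hcard]
  exact ⟨(LinearEquiv.ofInjectiveOfFinrankEq (fieldFrame X p).toLinearMap hinj
    hrank).toContinuousLinearEquiv, rfl⟩

theorem exists_straightening [FiniteDimensional ℂ V]
    (hX : ∀ j, AnalyticAt ℂ (X j) p)
    (hcomm : ∀ᶠ z in 𝓝 p, ∀ i j, VectorField.lieBracket ℂ (X i) (X j) z = 0)
    (hcard : Fintype.card ι = Module.finrank ℂ V) (hli : LinearIndependent ℂ fun j => X j p) :
    ∃ F : OpenPartialHomeomorph V (ι → ℂ), p ∈ F.source ∧ F p = 0 ∧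
      DifferentiableOn ℂ F F.source ∧
      ∀ ζ ∈ F.target, HasFDerivAt F.symm (fieldFrame X (F.symm ζ)) ζ := by
  have := FiniteDimensional.complete ℂ V
  have hXan : ∀ᶠ z in 𝓝 p, ∀ j, AnalyticAt ℂ (X j) z :=
    Filter.eventually_all.2 fun j => (hX j).eventually_analyticAt
  refine exists_openPartialHomeomorph_hasFDerivAt_symm (analyticAt_fieldFrame hX)
    (isInvertible_fieldFrame hcard hli) ?_
  filter_upwards [hXan, hcomm] with z hz hzcomm w w'
  rw [fderiv_fieldFrame_apply hz, fderiv_fieldFrame_apply hz]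
  simp only [fieldFrame_apply, map_sum, map_smul, Finset.smul_sum]
  rw [Finset.sum_comm]
  refine Finset.sum_congr rfl fun i _ => Finset.sum_congr rfl fun j _ => ?_
  rw [smul_comm, sub_eq_zero.1 (hzcomm i j)]

end Frame

end Straightening

/-! ### Fields invariant under imaginary translations -/

section RealStructure

variable {ι : Type*}

/-- The inclusion `ℝⁿ → ℂⁿ`. -/
noncomputable def realEmb : (ι → ℝ) →L[ℝ] ι → ℂ :=
  .pi fun j => Complex.ofRealCLM.comp (.proj j)

/-- The map `y ↦ i y` from `ℝⁿ` to `ℂⁿ`. -/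
noncomputable def imagEmb : (ι → ℝ) →L[ℝ] ι → ℂ :=
  .pi fun j => Complex.I • Complex.ofRealCLM.comp (.proj j)

/-- The coordinatewise real part; on `ℂ³` this is `rePart` as a continuous linear map. -/
noncomputable def reCLM : (ι → ℂ) →L[ℝ] ι → ℝ :=
  .pi fun j => Complex.reCLM.comp (.proj j)

/-- The coordinatewise imaginary part. -/
noncomputable def imCLM : (ι → ℂ) →L[ℝ] ι → ℝ :=
  .pi fun j => Complex.imCLM.comp (.proj j)

@[simp] theorem realEmb_apply (x : ι → ℝ) (j : ι) : realEmb x j = x j := rfl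

@[simp] theorem imagEmb_apply (y : ι → ℝ) (j : ι) : imagEmb y j = Complex.I * y j := rfl

@[simp] theorem reCLM_apply (z : ι → ℂ) (j : ι) : reCLM z j = (z j).re := rfl

@[simp] theorem imCLM_apply (z : ι → ℂ) (j : ι) : imCLM z j = (z j).im := rfl

theorem realEmb_reCLM_add_imagEmb_imCLM (z : ι → ℂ) :
    realEmb (reCLM z) + imagEmb (imCLM z) = z := by
  ext j
  simpa [mul_comm] using Complex.re_add_im (z j)

theorem realEmb_eq_neg_I_smul_imagEmb (x : ι → ℝ) : realEmb x = -Complex.I • imagEmb x := by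
  ext j
  simp [← mul_assoc]

theorem reCLM_realEmb (x : ι → ℝ) : reCLM (realEmb x) = x := by
  ext j
  simp

theorem reCLM_imagEmb (y : ι → ℝ) : reCLM (imagEmb y) = 0 := by
  ext j
  simp

theorem reCLM_neg_I_smul (z : ι → ℂ) : reCLM (-Complex.I • z) = imCLM z := by
  ext j
  simp

theorem imCLM_neg_I_smul (z : ι → ℂ) : imCLM (-Complex.I • z) = -reCLM z := by
  ext j
  simp

end RealStructure

theorem isDefiningFunctionAt_tube {φ : R3 → ℝ} {Γ : Set R3} {q : C3}
    (h : IsDefiningFunctionAt φ Γ (rePart q)) :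
    IsDefiningFunctionAt (φ ∘ reCLM) (tube Γ) q where
  analyticAt := h.analyticAt.comp (reCLM.analyticAt q)
  map_eq_zero := h.map_eq_zero
  fderiv_ne_zero h0 := h.fderiv_ne_zero <| by
    have hderiv : HasFDerivAt (φ ∘ reCLM) _ q :=
      h.analyticAt.differentiableAt.hasFDerivAt.comp q reCLM.hasFDerivAt
    rw [hderiv.fderiv] at h0
    ext1 v
    simpa [reCLM_realEmb] using DFunLike.congr_fun h0 (realEmb v)
  mem_iff := reCLM.continuous.continuousAt.eventually h.mem_iff

theorem eventually_forall_eq_add_of_hasFDerivAt {V W κ : Type*} [NormedAddCommGroup V]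
    [NormedSpace ℝ V] [NormedAddCommGroup W] [NormedSpace ℝ W] {f : κ → V → W}
    {f' : κ → V →L[ℝ] W} {p : V} (hf : ∀ᶠ x in 𝓝 p, ∀ k, HasFDerivAt (f k) (f' k) x) :
    ∀ᶠ x in 𝓝 p, ∀ k, f k x = f k p + f' k (x - p) := by
  obtain ⟨r, hr, hball⟩ := Metric.eventually_nhds_iff_ball.1 hf
  filter_upwards [Metric.ball_mem_nhds p hr] with x hx k
  have hle := (convex_ball p r).norm_image_sub_le_of_norm_hasFDerivWithin_le' (φ := f' k) (C := 0)
    (fun y hy => (hball y hy k).hasFDerivWithinAt) (fun y _ => by simp)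
    (Metric.mem_ball_self hr) hx
  rw [zero_mul, norm_le_zero_iff, sub_sub, sub_eq_zero] at hle
  exact hle

section Translations

variable {ι : Type*} [Fintype ι] {L : Type*} [LieRing L] [LieAlgebra ℝ L] {Ψ : (ι → ℂ) → ℝ}
  {N : Set (ι → ℂ)} {σ : L →ₗ[ℝ] (ι → ℂ) → ι → ℂ} {E : (ι → ℝ) →ₗ[ℝ] L}

namespace IsRealizationAt

theorem eventually_fderiv_imagEmb (h : IsRealizationAt Ψ N 0 σ)
    (hE : ∀ᶠ ζ in 𝓝 0, ∀ y, σ (E y) ζ = imagEmb y) :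
    ∀ᶠ ζ in 𝓝 0, ∀ Z y, fderiv ℂ (σ Z) ζ (imagEmb y) = σ ⁅E y, Z⁆ ζ := by
  filter_upwards [hE.eventually_nhds, h.map_lie] with ζ hζ hlie Z y
  have hconst : fderiv ℂ (σ (E y)) ζ = 0 := by
    have heq : σ (E y) =ᶠ[𝓝 ζ] fun _ => imagEmb y := hζ.mono fun _ h => h y
    rw [heq.fderiv_eq, fderiv_fun_const, Pi.zero_apply]
  rw [hlie, VectorField.lieBracket, hζ.self_of_nhds, hconst, zero_apply, sub_zero]

theorem eventually_hasFDerivAt_comp_realEmb (h : IsRealizationAt Ψ N 0 σ)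
    (hE : ∀ᶠ ζ in 𝓝 0, ∀ y, σ (E y) ζ = imagEmb y) :
    ∀ᶠ x in 𝓝 0, ∀ Z, ∃ D : (ι → ℝ) →L[ℝ] ι → ℂ, HasFDerivAt (fun x => σ Z (realEmb x)) D x ∧
      ∀ y, D y = -Complex.I • σ ⁅E y, Z⁆ (realEmb x) := by
  have hreal : Filter.Tendsto (realEmb (ι := ι)) (𝓝 0) (𝓝 0) :=
    realEmb.continuous.tendsto' 0 0 (map_zero _)
  filter_upwards [hreal.eventually (h.eventually_fderiv_imagEmb hE),
    hreal.eventually h.eventually_analyticAt] with x hx han Z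
  refine ⟨_, ((han Z).differentiableAt.hasFDerivAt.restrictScalars ℝ).comp x
    realEmb.hasFDerivAt, fun y => ?_⟩
  rw [ContinuousLinearMap.comp_apply, ContinuousLinearMap.coe_restrictScalars',
    realEmb_eq_neg_I_smul_imagEmb y, map_smul, hx]

theorem eventually_imCLM_eq (h : IsRealizationAt Ψ N 0 σ)
    (hE : ∀ᶠ ζ in 𝓝 0, ∀ y, σ (E y) ζ = imagEmb y) :
    ∀ᶠ x in 𝓝 0, ∀ Z, (∀ y, ⁅E y, Z⁆ ∈ LinearMap.range E) →
      imCLM (σ Z (realEmb x)) = imCLM (σ Z 0) := by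
  have hconst := eventually_forall_eq_add_of_hasFDerivAt (p := 0)
    (κ := {Z : L // ∀ y, ⁅E y, Z⁆ ∈ LinearMap.range E})
    (f := fun Z x => imCLM (σ Z (realEmb x))) (f' := 0) <| by
    filter_upwards [h.eventually_hasFDerivAt_comp_realEmb hE,
      (realEmb.continuous.tendsto' 0 0 (map_zero _)).eventually hE] with x hx hEx ⟨Z, hZ⟩
    obtain ⟨D, hD, hDE⟩ := hx Z
    refine (imCLM.hasFDerivAt.comp x hD).congr_fderiv ?_
    ext1 y
    obtain ⟨s, hs⟩ := hZ y
    rw [ContinuousLinearMap.comp_apply, hDE, ← hs, hEx, imCLM_neg_I_smul, reCLM_imagEmb, neg_zero]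
    rfl
  filter_upwards [hconst] with x hx Z hZ
  simpa using hx ⟨Z, hZ⟩

theorem exists_eventually_reCLM_eq_add (h : IsRealizationAt Ψ N 0 σ)
    (hE : ∀ᶠ ζ in 𝓝 0, ∀ y, σ (E y) ζ = imagEmb y)
    {Z : L} (hlie : ∀ y y', ⁅E y, ⁅E y', Z⁆⁆ ∈ LinearMap.range E) :
    ∃ A : (ι → ℝ) →L[ℝ] ι → ℝ, ∀ᶠ x in 𝓝 0,
      reCLM (σ Z (realEmb x)) = reCLM (σ Z 0) + A x := by
  let A : (ι → ℝ) →ₗ[ℝ] ι → ℝ :=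
    { toFun y := imCLM (σ ⁅E y, Z⁆ 0)
      map_add' := by simp
      map_smul' := by simp }
  refine ⟨A.toContinuousLinearMap, ?_⟩
  have haffine := eventually_forall_eq_add_of_hasFDerivAt (p := 0) (κ := Unit)
    (f := fun _ x => reCLM (σ Z (realEmb x))) (f' := fun _ => A.toContinuousLinearMap) <| by
    filter_upwards [h.eventually_hasFDerivAt_comp_realEmb hE, h.eventually_imCLM_eq hE]
      with x hx him _
    obtain ⟨D, hD, hDE⟩ := hx Z
    refine (reCLM.hasFDerivAt.comp x hD).congr_fderiv ?_
    ext1 y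
    rw [ContinuousLinearMap.comp_apply, hDE, reCLM_neg_I_smul, him _ fun y' => hlie y' y]
    rfl
  filter_upwards [haffine] with x hx
  simpa using hx ()

theorem eventually_fderiv_imagEmb_eq_zero (h : IsRealizationAt Ψ N 0 σ)
    (hE : ∀ᶠ ζ in 𝓝 0, ∀ y, σ (E y) ζ = imagEmb y) :
    ∀ᶠ ζ in 𝓝 0, Ψ ζ = 0 → ∀ y, fderiv ℝ Ψ ζ (imagEmb y) = 0 := by
  filter_upwards [hE, h.tangent] with ζ hEζ htangent h0 y
  rw [← hEζ]
  exact htangent h0 _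

theorem eventually_mem_iff_realEmb_reCLM_mem (h : IsRealizationAt Ψ N 0 σ)
    (hE : ∀ᶠ ζ in 𝓝 0, ∀ y, σ (E y) ζ = imagEmb y) :
    ∀ᶠ ζ in 𝓝 0, (ζ ∈ N ↔ realEmb (reCLM ζ) ∈ N) := by
  have hzero := eventually_eq_zero_iff_add h.defining.analyticAt h.defining.map_eq_zero
    h.defining.fderiv_ne_zero imagEmb (h.eventually_fderiv_imagEmb_eq_zero hE)
  have hpair : Filter.Tendsto (fun ζ : ι → ℂ => (ζ, -imCLM ζ)) (𝓝 0) (𝓝 (0, 0)) := by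
    have hcont : Continuous fun ζ : ι → ℂ => (ζ, -imCLM ζ) := by fun_prop
    exact hcont.tendsto' 0 _ (by simp)
  have hproj : Filter.Tendsto (fun ζ : ι → ℂ => realEmb (reCLM ζ)) (𝓝 0) (𝓝 0) :=
    (realEmb.comp reCLM).continuous.tendsto' 0 0 (map_zero _)
  filter_upwards [hpair.eventually hzero, h.defining.mem_iff, hproj.eventually h.defining.mem_iff]
    with ζ hζ hmem hmem'
  have hre : ζ + imagEmb (-imCLM ζ) = realEmb (reCLM ζ) := by
    rw [map_neg, ← sub_eq_add_neg, sub_eq_iff_eq_add, realEmb_reCLM_add_imagEmb_imCLM]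
  rw [hmem, hζ, hre, hmem']

theorem eventually_fderiv_comp_realEmb (h : IsRealizationAt Ψ N 0 σ) :
    ∀ᶠ x in 𝓝 0, ∀ v, fderiv ℝ (Ψ ∘ realEmb) x v = fderiv ℝ Ψ (realEmb x) (realEmb v) := by
  filter_upwards [(realEmb.continuous.tendsto' 0 0 (map_zero _)).eventually
    h.defining.analyticAt.eventually_analyticAt] with x hx v
  exact DFunLike.congr_fun
    (hx.differentiableAt.hasFDerivAt.comp x realEmb.hasFDerivAt).fderiv v

theorem isDefiningFunctionAt_preimage_realEmb (h : IsRealizationAt Ψ N 0 σ)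
    (hE : ∀ᶠ ζ in 𝓝 0, ∀ y, σ (E y) ζ = imagEmb y) :
    IsDefiningFunctionAt (Ψ ∘ realEmb) (realEmb ⁻¹' N) 0 where
  analyticAt := by
    refine AnalyticAt.comp ?_ (realEmb.analyticAt (0 : ι → ℝ))
    rw [map_zero]
    exact h.defining.analyticAt
  map_eq_zero := by
    rw [Function.comp_apply, map_zero]
    exact h.defining.map_eq_zero
  fderiv_ne_zero h0 := h.defining.fderiv_ne_zero <| by
    ext1 ζ
    have hreal := h.eventually_fderiv_comp_realEmb.self_of_nhds (reCLM ζ)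
    rw [h0, zero_apply, map_zero] at hreal
    rw [← realEmb_reCLM_add_imagEmb_imCLM ζ, map_add, ← hreal,
      (h.eventually_fderiv_imagEmb_eq_zero hE).self_of_nhds h.defining.map_eq_zero, add_zero,
      zero_apply]
  mem_iff := (realEmb.continuous.tendsto' 0 0 (map_zero _)).eventually h.defining.mem_iff

end IsRealizationAt

end Translations

section Straightening

variable {V : Type*} [NormedAddCommGroup V] [NormedSpace ℝ V] [NormedSpace ℂ V]
  {L : Type*} [LieRing L] [LieAlgebra ℝ L]

theorem IsRealizationAt.exists_smul_straightening [FiniteDimensional ℂ V] {Φ : V → ℝ} {M : Set V}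
    {p : V} {ρ : L →ₗ[ℝ] V → V} (h : IsRealizationAt Φ M p ρ) {c : ℂ} (hc : c ≠ 0) {ι : Type*}
    [Fintype ι] {b : ι → L} (hcomm : ∀ i j, ⁅b i, b j⁆ = 0)
    (hcard : Fintype.card ι = Module.finrank ℂ V) (hli : LinearIndependent ℂ fun j => ρ (b j) p) :
    ∃ F : OpenPartialHomeomorph V (ι → ℂ), p ∈ F.source ∧ F p = 0 ∧
      DifferentiableOn ℂ F F.source ∧
      ∀ ζ ∈ F.target, HasFDerivAt F.symm (fieldFrame (fun j => c • ρ (b j)) (F.symm ζ)) ζ := by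
  refine exists_straightening (fun j => (h.analyticAt (b j)).const_smul) ?_ hcard
    (hli.units_smul fun _ => Units.mk0 c hc)
  filter_upwards [h.map_lie, h.eventually_analyticAt] with z hz han i j
  have hij : VectorField.lieBracket ℂ (ρ (b i)) (ρ (b j)) z = 0 := by
    rw [← hz, hcomm, map_zero, Pi.zero_apply]
  rw [VectorField.lieBracket_const_smul_left (han _).differentiableAt,
    VectorField.lieBracket_const_smul_right (han _).differentiableAt, hij, smul_zero, smul_zero]

end Straightening

section Tube

variable {L : Type*} [LieRing L] [LieAlgebra ℝ L]

namespace IsRealizationAt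

theorem affinelyHomogeneousAt_preimage_realEmb {Ψ : C3 → ℝ} {N : Set C3}
    {σ : L →ₗ[ℝ] C3 → C3} {E : R3 →ₗ[ℝ] L} (h : IsRealizationAt Ψ N 0 σ)
    (hE : ∀ᶠ ζ in 𝓝 0, ∀ y, σ (E y) ζ = imagEmb y)
    (hlie : ∀ y y' Z, ⁅E y, ⁅E y', Z⁆⁆ ∈ LinearMap.range E) :
    AffinelyHomogeneousAt (realEmb ⁻¹' N) 0 := by
  have hdef := h.isDefiningFunctionAt_preimage_realEmb hE
  refine ⟨_, hdef, fun v hv => ?_⟩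
  rw [h.eventually_fderiv_comp_realEmb.self_of_nhds, map_zero] at hv
  obtain ⟨Z, hZ⟩ := h.transitive _ hv
  obtain ⟨A, hA⟩ := h.exists_eventually_reCLM_eq_add hE fun y y' => hlie y y' Z
  refine ⟨A.toLinearMap.toAffineMap + AffineMap.const ℝ R3 v, by simp, ?_⟩
  have hreal : Filter.Tendsto (realEmb (ι := Fin 3)) (𝓝 0) (𝓝 0) :=
    realEmb.continuous.tendsto' 0 0 (map_zero _)
  filter_upwards [hA, h.eventually_fderiv_comp_realEmb, hdef.mem_iff,
    hreal.eventually h.tangent, hreal.eventually (h.eventually_fderiv_imagEmb_eq_zero hE)]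
    with x hAx hderiv hmem htangent himag hx
  have hval : (A.toLinearMap.toAffineMap + AffineMap.const ℝ R3 v) x =
      reCLM (σ Z (realEmb x)) := by
    rw [hAx, hZ, reCLM_realEmb, add_comm]
    rfl
  have htangentZ := htangent (hmem.1 hx) Z
  rwa [← realEmb_reCLM_add_imagEmb_imCLM (σ Z (realEmb x)), map_add, himag (hmem.1 hx), add_zero,
    ← hderiv, ← hval] at htangentZ

theorem exists_imagEmb_straightening {Φ : C3 → ℝ} {M : Set C3} {p : C3} {ρ : L →ₗ[ℝ] C3 → C3}
    (h : IsRealizationAt Φ M p ρ) {b : Fin 3 → L} (hcomm : ∀ i j, ⁅b i, b j⁆ = 0)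
    (hli : LinearIndependent ℂ fun j => ρ (b j) p) :
    ∃ F : OpenPartialHomeomorph C3 C3, p ∈ F.source ∧ F p = 0 ∧
      DifferentiableOn ℂ F F.source ∧ DifferentiableOn ℂ F.symm F.target ∧
      IsRealizationAt (Φ ∘ F.symm) (F.symm ⁻¹' M) 0 (pullbackField F.symm ∘ₗ ρ) ∧
      ∀ᶠ ζ in 𝓝 0, ∀ y,
        pullbackField F.symm (ρ (Fintype.linearCombination ℝ b y)) ζ = imagEmb y := by
  obtain ⟨F, hp, hFp, hF, hframe⟩ := h.exists_smul_straightening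
    (neg_ne_zero.2 Complex.I_ne_zero) hcomm (by simp) hli
  have hFsymm : ∀ ζ ∈ F.target, DifferentiableAt ℂ F.symm ζ :=
    fun ζ hζ => (hframe ζ hζ).differentiableAt
  have hinv : ∀ ζ ∈ F.target, (fderiv ℂ F.symm ζ).IsInvertible := fun ζ hζ =>
    isInvertible_fderiv_of_mem_source (F := F.symm) hζ (hFsymm ζ hζ)
      (hF.differentiableAt (F.open_source.mem_nhds (F.map_target hζ)))
  have h0 : (0 : C3) ∈ F.target := hFp ▸ F.map_source hp
  have hsymm0 : F.symm 0 = p := hFp ▸ F.left_inv hp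
  have htarget := F.open_target.eventually_mem h0
  refine ⟨F, hp, hFp, hF, fun ζ hζ => (hFsymm ζ hζ).differentiableWithinAt,
    (hsymm0.symm ▸ h).pullback (analyticAt_of_eventually_differentiableAt <|
      htarget.mono hFsymm) (hinv 0 h0), ?_⟩
  filter_upwards [htarget] with ζ hζ y
  refine pullbackField_apply_eq (hinv ζ hζ) ?_
  rw [(hframe ζ hζ).fderiv, fieldFrame_apply, Fintype.linearCombination_apply, map_sum,
    Finset.sum_apply]
  refine Finset.sum_congr rfl fun j _ => ?_
  have hI : Complex.I * y j * -Complex.I = (y j : ℂ) := by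
    linear_combination -(y j : ℂ) * Complex.I_mul_I
  rw [imagEmb_apply, Pi.smul_apply, smul_smul, hI, map_smul, Pi.smul_apply, Complex.coe_smul]

end IsRealizationAt

theorem HolomorphicallyEquivalentAt.of_eventually {M N : Set C3} {p : C3}
    {F : OpenPartialHomeomorph C3 C3} (hp : p ∈ F.source) (hF : DifferentiableOn ℂ F F.source)
    (hFsymm : DifferentiableOn ℂ F.symm F.target) (hMN : ∀ᶠ z in 𝓝 p, (z ∈ M ↔ F z ∈ N)) :
    HolomorphicallyEquivalentAt M p N (F p) := by
  obtain ⟨s, hs, hso, hps⟩ := eventually_nhds_iff.1 hMN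
  exact ⟨F.restrOpen s hso, ⟨hp, hps⟩, rfl, hF.mono Set.inter_subset_left,
    hFsymm.mono Set.inter_subset_left, fun z hz => hs z hz.2⟩

theorem IsRealizationAt.exists_tube {Φ : C3 → ℝ} {M : Set C3} {p : C3} {ρ : L →ₗ[ℝ] C3 → C3}
    (h : IsRealizationAt Φ M p ρ) {b : Fin 3 → L} (hcomm : ∀ i j, ⁅b i, b j⁆ = 0)
    (hli : LinearIndependent ℂ fun j => ρ (b j) p)
    (hlie : ∀ X ∈ Submodule.span ℝ (Set.range b), ∀ Y ∈ Submodule.span ℝ (Set.range b), ∀ Z,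
      ⁅X, ⁅Y, Z⁆⁆ ∈ Submodule.span ℝ (Set.range b)) :
    ∃ (Γ : Set R3) (q : C3), AffinelyHomogeneousAt Γ (rePart q) ∧
      HolomorphicallyEquivalentAt M p (tube Γ) q := by
  obtain ⟨F, hp, hFp, hF, hFsymm, hσ, hE⟩ := h.exists_imagEmb_straightening hcomm hli
  simp only [← Fintype.range_linearCombination, LinearMap.mem_range,
    forall_exists_index, forall_apply_eq_imp_iff] at hlie
  refine ⟨realEmb ⁻¹' (F.symm ⁻¹' M), 0,
    hσ.affinelyHomogeneousAt_preimage_realEmb hE hlie, ?_⟩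
  rw [← hFp]
  refine .of_eventually hp hF hFsymm ?_
  have hmem := hσ.eventually_mem_iff_realEmb_reCLM_mem hE
  rw [← hFp] at hmem
  filter_upwards [(F.continuousAt hp).eventually hmem, F.eventually_left_inverse hp]
    with z hz hleft
  rw [Set.mem_preimage, hleft] at hz
  exact hz

theorem LeviNondegenerateAt.of_not_leviDegenerateAt {M : Set C3} {p q : C3} {Γ : Set R3}
    (hM : ¬ LeviDegenerateAt M p) (hΓ : AffinelyHomogeneousAt Γ (rePart q))
    (h : HolomorphicallyEquivalentAt M p (tube Γ) q) : LeviNondegenerateAt (tube Γ) q := by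
  obtain ⟨φ, hφ, -⟩ := hΓ
  have hdef := isDefiningFunctionAt_tube hφ
  exact ⟨_, hdef, fun hker =>
    hM (LeviDegenerateAt.of_holomorphicallyEquivalentAt ⟨_, hdef, hker⟩ h)⟩

end Tube

/-! ### Ideals isomorphic to `g_{3,1} + g_1` -/

section HeisenbergPlusLine

variable {L : Type*} [LieRing L] [LieAlgebra ℝ L]

/-- `f` is a basis of the ideal `I` whose brackets are those of `g_{3,1} + g_1`: the vectors `f 0`,
`f 1`, `f 2` span the Heisenberg algebra with centre `f 0`, and `f 3` spans the line. -/
structure IsHeisenbergBasis (f : Fin 4 → L) (I : LieIdeal ℝ L) : Prop where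
  linearIndependent : LinearIndependent ℝ f
  span_eq : Submodule.span ℝ (Set.range f) = I.toSubmodule
  lie_one_two : ⁅f 1, f 2⁆ = f 0
  lie_zero_one : ⁅f 0, f 1⁆ = 0
  lie_zero_two : ⁅f 0, f 2⁆ = 0
  lie_zero_three : ⁅f 0, f 3⁆ = 0
  lie_one_three : ⁅f 1, f 3⁆ = 0
  lie_two_three : ⁅f 2, f 3⁆ = 0

theorem isHeisenbergPlusLine_iff_exists_isHeisenbergBasis {I : LieIdeal ℝ L} :
    IsHeisenbergPlusLine I ↔ ∃ f, IsHeisenbergBasis f I := by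
  constructor
  · rintro ⟨f, h₁₂, h₀₁, h₀₂, h₀₃, h₁₃, h₂₃⟩
    refine ⟨fun i => f i, ⟨f.linearIndependent.map' I.toSubmodule.subtype
      I.toSubmodule.ker_subtype, ?_, congrArg Subtype.val h₁₂, congrArg Subtype.val h₀₁,
      congrArg Subtype.val h₀₂, congrArg Subtype.val h₀₃, congrArg Subtype.val h₁₃,
      congrArg Subtype.val h₂₃⟩⟩
    have hspan := congrArg (Submodule.map I.toSubmodule.subtype) f.span_eq
    rwa [Submodule.map_span, ← Set.range_comp, Submodule.map_top, Submodule.range_subtype]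
      at hspan
  · rintro ⟨f, hf⟩
    let b : Module.Basis (Fin 4) ℝ I :=
      (Module.Basis.span hf.linearIndependent).map (LinearEquiv.ofEq _ _ hf.span_eq)
    have hb (i : Fin 4) : (b i : L) = f i :=
      congrArg Subtype.val (Module.Basis.span_apply hf.linearIndependent i)
    refine ⟨b, ?_⟩
    simp only [Subtype.ext_iff, LieIdeal.coe_bracket_of_module, LieSubmodule.coe_bracket, hb,
      ZeroMemClass.coe_zero]
    exact ⟨hf.lie_one_two, hf.lie_zero_one, hf.lie_zero_two, hf.lie_zero_three, hf.lie_one_three,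
      hf.lie_two_three⟩

namespace IsHeisenbergBasis

variable {f : Fin 4 → L} {I : LieIdeal ℝ L}

theorem apply_mem (hf : IsHeisenbergBasis f I) (i : Fin 4) : f i ∈ I := by
  rw [← LieSubmodule.mem_toSubmodule, ← hf.span_eq]
  exact Submodule.subset_span ⟨i, rfl⟩

theorem exists_eq_sum (hf : IsHeisenbergBasis f I) {X : L} (hX : X ∈ I) :
    ∃ c : Fin 4 → ℝ, ∑ i, c i • f i = X := by
  rw [← LieSubmodule.mem_toSubmodule, ← hf.span_eq] at hX
  exact (Submodule.mem_span_range_iff_exists_fun ℝ).1 hX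

theorem lie_sum_smul (hf : IsHeisenbergBasis f I) (c d : Fin 4 → ℝ) :
    ⁅∑ i, c i • f i, ∑ i, d i • f i⁆ = (c 1 * d 2 - c 2 * d 1) • f 0 := by
  have h₂₁ : ⁅f 2, f 1⁆ = -f 0 := by rw [← lie_skew, hf.lie_one_two]
  have h₁₀ : ⁅f 1, f 0⁆ = 0 := by rw [← lie_skew, hf.lie_zero_one, neg_zero]
  have h₂₀ : ⁅f 2, f 0⁆ = 0 := by rw [← lie_skew, hf.lie_zero_two, neg_zero]
  have h₃₀ : ⁅f 3, f 0⁆ = 0 := by rw [← lie_skew, hf.lie_zero_three, neg_zero]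
  have h₃₁ : ⁅f 3, f 1⁆ = 0 := by rw [← lie_skew, hf.lie_one_three, neg_zero]
  have h₃₂ : ⁅f 3, f 2⁆ = 0 := by rw [← lie_skew, hf.lie_two_three, neg_zero]
  simp only [Fin.sum_univ_four, add_lie, lie_add, smul_lie, lie_smul, lie_self, hf.lie_one_two,
    hf.lie_zero_one, hf.lie_zero_two, hf.lie_zero_three, hf.lie_one_three, hf.lie_two_three,
    h₂₁, h₁₀, h₂₀, h₃₀, h₃₁, h₃₂]
  module

theorem lie_mem_span_singleton (hf : IsHeisenbergBasis f I) {X Y : L} (hX : X ∈ I) (hY : Y ∈ I) :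
    ⁅X, Y⁆ ∈ Submodule.span ℝ {f 0} := by
  obtain ⟨c, rfl⟩ := hf.exists_eq_sum hX
  obtain ⟨d, rfl⟩ := hf.exists_eq_sum hY
  rw [hf.lie_sum_smul]
  exact Submodule.smul_mem _ _ (Submodule.mem_span_singleton_self _)

theorem zero_lie (hf : IsHeisenbergBasis f I) {Y : L} (hY : Y ∈ I) : ⁅f 0, Y⁆ = 0 := by
  obtain ⟨d, rfl⟩ := hf.exists_eq_sum hY
  simpa using hf.lie_sum_smul (Pi.single 0 1) d

theorem three_lie (hf : IsHeisenbergBasis f I) {Y : L} (hY : Y ∈ I) : ⁅f 3, Y⁆ = 0 := by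
  obtain ⟨d, rfl⟩ := hf.exists_eq_sum hY
  simpa using hf.lie_sum_smul (Pi.single 3 1) d

theorem mem_span_pair_of_lie_eq_zero (hf : IsHeisenbergBasis f I) {X : L} (hX : X ∈ I)
    (h : ∀ Y ∈ I, ⁅X, Y⁆ = 0) : X ∈ Submodule.span ℝ {f 0, f 3} := by
  obtain ⟨c, rfl⟩ := hf.exists_eq_sum hX
  have hne := hf.linearIndependent.ne_zero 0
  have h1 : c 1 = 0 := by
    simpa [h _ (hf.apply_mem 2), hne] using (hf.lie_sum_smul c (Pi.single 2 1)).symm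
  have h2 : c 2 = 0 := by
    simpa [h _ (hf.apply_mem 1), hne] using (hf.lie_sum_smul c (Pi.single 1 1)).symm
  exact Submodule.mem_span_pair.2 ⟨c 0, c 3, by simp [Fin.sum_univ_four, h1, h2]⟩

theorem zero_lie_mem_span_pair (hf : IsHeisenbergBasis f I) (Z : L) :
    ⁅f 0, Z⁆ ∈ Submodule.span ℝ {f 0, f 3} := by
  refine hf.mem_span_pair_of_lie_eq_zero (lie_mem_left ℝ L I _ _ (hf.apply_mem 0)) fun Y hY => ?_
  rw [lie_lie, hf.zero_lie hY, lie_zero, sub_zero, hf.zero_lie (I.lie_mem hY)]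

end IsHeisenbergBasis

end HeisenbergPlusLine

section BlockIV

theorem lie_mem_of_basis {R L ι : Type*} [CommRing R] [LieRing L] [LieAlgebra R L] [Finite ι]
    [LinearOrder ι] (e : Module.Basis ι R L) {S : Submodule R L}
    (h : ∀ i j, i < j → ⁅e i, e j⁆ ∈ S) (X Y : L) : ⁅X, Y⁆ ∈ S := by
  have hbasis (i j : ι) : ⁅e i, e j⁆ ∈ S := by
    rcases lt_trichotomy i j with hij | rfl | hij
    · exact h i j hij
    · rw [lie_self]
      exact S.zero_mem
    · rw [← lie_skew]
      exact S.neg_mem (h j i hij)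
  have := Fintype.ofFinite ι
  rw [← e.sum_repr X, ← e.sum_repr Y]
  simp only [sum_lie_sum, smul_lie, lie_smul]
  exact S.sum_mem fun i _ => S.sum_mem fun j _ => S.smul_mem _ (S.smul_mem _ (hbasis _ _))

variable {L : Type*} [LieRing L] [LieAlgebra ℝ L]

theorem BlockIVRelations.exists_relations {e : Fin 5 → L} (h : BlockIVRelations e) :
    ∃ b : Fin 4 → L, Relations e (b 0) (b 1) (b 2) (b 3) ∧
      ∀ i, b i ∈ Submodule.span ℝ (Set.range fun i : Fin 4 => e i.castSucc) := by
  set S := Submodule.span ℝ (Set.range fun i : Fin 4 => e i.castSucc)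
  have he (i : Fin 4) : e i.castSucc ∈ S := Submodule.subset_span ⟨i, rfl⟩
  have h0 : e 0 ∈ S := he 0
  have h1 : e 1 ∈ S := he 1
  have h2 : e 2 ∈ S := he 2
  have h3 : e 3 ∈ S := he 3
  suffices hb : ∃ b₁ b₂ b₃ b₄, Relations e b₁ b₂ b₃ b₄ ∧ b₁ ∈ S ∧ b₂ ∈ S ∧ b₃ ∈ S ∧ b₄ ∈ S by
    obtain ⟨b₁, b₂, b₃, b₄, hrel, hb⟩ := hb
    exact ⟨![b₁, b₂, b₃, b₄], hrel, by simpa [Fin.forall_fin_succ] using hb⟩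
  rcases h with ⟨_, _, _, h⟩ | ⟨_, h⟩ | h | h | ⟨_, _, h⟩ | ⟨_, _, h⟩ | ⟨_, _, _, h⟩ |
    ⟨_, _, _, h⟩ | h | ⟨_, h⟩ | h <;>
  exact ⟨_, _, _, _, h, by apply_rules [zero_mem, add_mem, neg_mem, S.smul_mem],
    by apply_rules [zero_mem, add_mem, neg_mem, S.smul_mem],
    by apply_rules [zero_mem, add_mem, neg_mem, S.smul_mem],
    by apply_rules [zero_mem, add_mem, neg_mem, S.smul_mem]⟩

theorem IsBlockIV.finrank_eq (hL : IsBlockIV L) : Module.finrank ℝ L = 5 := by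
  obtain ⟨e, -⟩ := hL
  rw [Module.finrank_eq_card_basis e, Fintype.card_fin]

theorem IsBlockIV.exists_ideal (hL : IsBlockIV L) :
    ∃ I : LieIdeal ℝ L, IsHeisenbergPlusLine I := by
  obtain ⟨e, he⟩ := hL
  obtain ⟨b, h, hb⟩ := he.exists_relations
  set S := Submodule.span ℝ (Set.range fun i : Fin 4 => e i.castSucc)
  have he0 : e 0 ∈ S := Submodule.subset_span ⟨0, rfl⟩
  have hbasis (i j : Fin 5) (hij : i < j) : ⁅e i, e j⁆ ∈ S := by
    fin_cases i <;> fin_cases j <;> try simp at hij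
    all_goals simp [h.e12, h.e13, h.e14, h.e15, h.e23, h.e24, h.e25, h.e34, h.e35, h.e45, hb, he0]
  let I : LieIdeal ℝ L := { S with lie_mem := fun _ => lie_mem_of_basis e hbasis _ _ }
  refine ⟨I, isHeisenbergPlusLine_iff_exists_isHeisenbergBasis.2
    ⟨fun i => e i.castSucc, e.linearIndependent.comp _ (Fin.castSucc_injective 4), rfl,
      h.e23, h.e12, h.e13, h.e14, h.e24, h.e34⟩⟩

end BlockIV

/-! ### Realizations of algebras with an ideal `g_{3,1} + g_1` -/

namespace IsRealizationAt

variable {L : Type*} [LieRing L] [LieAlgebra ℝ L] {Φ : C3 → ℝ} {M : Set C3} {p : C3}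
  {ρ : L →ₗ[ℝ] C3 → C3} {f : Fin 4 → L} {I : LieIdeal ℝ L}

theorem leviDegenerateAt_of_apply_eq_smul (h : IsRealizationAt Φ M p ρ)
    (hf : IsHeisenbergBasis f I) (h0 : ρ (f 0) p ≠ 0) {c : ℂ} (hc : c.im ≠ 0)
    (h3 : ρ (f 3) p = c • ρ (f 0) p) : LeviDegenerateAt M p := by
  refine h.leviDegenerateAt h0 (b := c.im⁻¹ • (f 3 - c.re • f 0)) ?_ fun Z => ?_
  · have hvalue : ρ (f 3) p - c.re • ρ (f 0) p = c.im • Complex.I • ρ (f 0) p := by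
      rw [h3, ← Complex.coe_smul, ← Complex.coe_smul, smul_smul, ← sub_smul]
      congr 1
      linear_combination c.re_add_im.symm
    simp only [map_smul, map_sub, Pi.smul_apply, Pi.sub_apply, hvalue, inv_smul_smul₀ hc]
  · obtain ⟨s, t, hst⟩ := Submodule.mem_span_pair.1 (hf.zero_lie_mem_span_pair Z)
    refine ⟨s + t * c, ?_⟩
    rw [← hst, map_add, map_smul, map_smul, Pi.add_apply, Pi.smul_apply, Pi.smul_apply, h3,
      ← Complex.coe_smul, ← Complex.coe_smul, smul_smul, ← add_smul]

theorem exists_tube_of_notMem_span_pair (h : IsRealizationAt Φ M p ρ)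
    (hf : IsHeisenbergBasis f I) (h03 : LinearIndependent ℂ ![ρ (f 0) p, ρ (f 3) p]) {x : L}
    (hx : x ∈ I) (hxp : ρ x p ∉ Submodule.span ℂ {ρ (f 0) p, ρ (f 3) p}) :
    ∃ Γ q, AffinelyHomogeneousAt Γ (rePart q) ∧ HolomorphicallyEquivalentAt M p (tube Γ) q := by
  have hI : Submodule.span ℝ (Set.range ![x, f 0, f 3]) ≤ I.toSubmodule := by
    rw [Submodule.span_le, Set.range_subset_iff]
    simpa [Fin.forall_fin_succ] using ⟨hx, hf.apply_mem 0, hf.apply_mem 3⟩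
  have h0 : Submodule.span ℝ {f 0} ≤ Submodule.span ℝ (Set.range ![x, f 0, f 3]) :=
    Submodule.span_mono (Set.singleton_subset_iff.2 ⟨1, rfl⟩)
  refine h.exists_tube (b := ![x, f 0, f 3]) ?_ ?_ fun X hX Y hY Z =>
    h0 (hf.lie_mem_span_singleton (hI hX) (lie_mem_left ℝ L I _ _ (hI hY)))
  · have hx0 : ⁅x, f 0⁆ = 0 := by rw [← lie_skew, hf.zero_lie hx, neg_zero]
    have hx3 : ⁅x, f 3⁆ = 0 := by rw [← lie_skew, hf.three_lie hx, neg_zero]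
    intro i j
    fin_cases i <;> fin_cases j <;>
      simp [hx0, hx3, hf.zero_lie, hf.three_lie, hx, hf.apply_mem]
  · have hcons : (fun j => ρ (![x, f 0, f 3] j) p) =
        Matrix.vecCons (ρ x p) ![ρ (f 0) p, ρ (f 3) p] := by
      ext j : 1
      fin_cases j <;> rfl
    rw [hcons]
    exact linearIndependent_finCons.2 ⟨h03, by simpa [Matrix.range_cons, Set.pair_comm] using hxp⟩

theorem leviDegenerateAt_or_exists_tube (h : IsRealizationAt Φ M p ρ)
    (hL : Module.finrank ℝ L = 5) (hf : IsHeisenbergBasis f I) :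
    LeviDegenerateAt M p ∨
      ∃ Γ q, AffinelyHomogeneousAt Γ (rePart q) ∧ HolomorphicallyEquivalentAt M p (tube Γ) q := by
  have : FiniteDimensional ℝ L := .of_finrank_pos (by rw [hL]; norm_num)
  have hC3 : Module.finrank ℝ L + 1 = Module.finrank ℝ C3 := by
    rw [hL, Module.finrank_pi_fintype]
    simp [Complex.finrank_real_complex]
  have hinj {X : L} (hX : ρ X p = 0) : X = 0 := h.eq_zero_of_apply_eq_zero hC3 hX
  have h0 : ρ (f 0) p ≠ 0 := fun h0 => hf.linearIndependent.ne_zero 0 (hinj h0)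
  by_cases h03 : LinearIndependent ℂ ![ρ (f 0) p, ρ (f 3) p]
  · right
    rcases h.notMem_span_pair hf.lie_one_two hf.lie_zero_one hf.lie_zero_two hf.lie_zero_three
      hf.lie_one_three hf.lie_two_three h0 with h1 | h2
    · exact h.exists_tube_of_notMem_span_pair hf h03 (hf.apply_mem 1) h1
    · exact h.exists_tube_of_notMem_span_pair hf h03 (hf.apply_mem 2) h2
  · left
    simp only [LinearIndependent.pair_iff' h0, not_forall, not_not] at h03
    obtain ⟨c, hc⟩ := h03
    refine h.leviDegenerateAt_of_apply_eq_smul hf h0 (fun him => ?_) hc.symm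
    have hreal : f 3 = c.re • f 0 := sub_eq_zero.1 <| hinj <| by
      have hcre : (c.re : ℂ) = c := Complex.ext rfl him.symm
      rw [map_sub, map_smul, Pi.sub_apply, Pi.smul_apply, ← Complex.coe_smul, hcre, hc, sub_self]
    exact absurd (hf.linearIndependent.eq_of_smul_apply_eq_smul_apply 1 c.re 3 0 one_ne_zero
      (by rwa [one_smul])) (by decide)

end IsRealizationAt

end CRHyp

theorem mainTheorem3_general {L : Type*} [LieRing L] [LieAlgebra ℝ L]
    (hL : Module.finrank ℝ L = 5) {I : LieIdeal ℝ L} (hI : CRHyp.IsHeisenbergPlusLine I)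
    {M : Set CRHyp.C3} {p : CRHyp.C3} (hM : CRHyp.IsAssociatedWith M p L) :
    CRHyp.LeviDegenerateAt M p ∨
      ∃ (Γ : Set CRHyp.R3) (q : CRHyp.C3),
        CRHyp.AffinelyHomogeneousAt Γ (CRHyp.rePart q) ∧
        CRHyp.LeviNondegenerateAt (CRHyp.tube Γ) q ∧
        CRHyp.HolomorphicallyEquivalentAt M p (CRHyp.tube Γ) q := by
  obtain ⟨f, hf⟩ := CRHyp.isHeisenbergPlusLine_iff_exists_isHeisenbergBasis.1 hI
  obtain ⟨Φ, ρ, h⟩ := hM.exists_isRealizationAt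
  refine or_iff_not_imp_left.2 fun hdeg => ?_
  obtain ⟨Γ, q, hΓ, hq⟩ := (h.leviDegenerateAt_or_exists_tube hL hf).resolve_left hdeg
  exact ⟨Γ, q, hΓ, .of_not_leviDegenerateAt hdeg hΓ hq, hq⟩

theorem mainTheorem3 {L : Type*} [LieRing L] [LieAlgebra ℝ L] (hL : CRHyp.IsBlockIV L) :
    (∃ I : LieIdeal ℝ L, CRHyp.IsHeisenbergPlusLine I) ∧
    ∀ (M : Set CRHyp.C3) (p : CRHyp.C3), CRHyp.IsAssociatedWith M p L →
      CRHyp.LeviDegenerateAt M p ∨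
      ∃ (Γ : Set CRHyp.R3) (q : CRHyp.C3),
        CRHyp.AffinelyHomogeneousAt Γ (CRHyp.rePart q) ∧
        CRHyp.LeviNondegenerateAt (CRHyp.tube Γ) q ∧
        CRHyp.HolomorphicallyEquivalentAt M p (CRHyp.tube Γ) q := by
  obtain ⟨I, hI⟩ := hL.exists_ideal
  exact ⟨⟨I, hI⟩, fun _ _ hM => mainTheorem3_general hL.finrank_eq hI hM⟩
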